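/- Let $S$ be a set of $n\ge 2$ points in $\mathbb{R}^3$, each of which is assigned a color; no general position is assumed. Choose a uniformly random ordering of the color classes and, independently for each color class, a uniformly random ordering of its points. Insert the points one by one, class after class in the chosen order of the classes, and within each class in the chosen order of its points. When a point $p$ is inserted after a set $V$ of points, the number of structural changes is the number of vertices, edges and facets (faces of dimension $0$, $1$, $2$, regarded as subsets of $\mathbb{R}^3$, including the hull itself when its dimension is at most $2$) of $\mathrm{conv}(V\cup\{p\})$ that are not faces of $\mathrm{conv}(V)$, plus the number of those of $\mathrm{conv}(V)$ that are not faces of $\mathrm{conv}(V\cup\{p\})$. Let $X$ be the total number of structural changes over all $n$ insertions, starting from the empty set. Then $\mathbb{E}[X]=O(n\log n)$: there is an absolute constant $C>0$ with $\mathbb{E}[X]\le C\,n\log n$ for all such $S$ and all colorings. This bound is tight: there is an absolute constant $c>0$ such that for every $n\ge 2$ there is a set of $n$ colored points in $\mathbb{R}^3$ with $\mathbb{E}[X]\ge c\,n\log n$. -/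

import Mathlib

open scoped BigOperators

noncomputable section

/-- Three-dimensional Euclidean space. -/
abbrev E3 : Type := EuclideanSpace ℝ (Fin 3)

namespace ColoredHull

/-- The features of the convex hull of a point set `V` in three-space: its vertices, edges and
facets, that is, the nonempty exposed faces of dimension 0, 1 and 2, as subsets of space. (While
`V` is still coplanar, the hull itself is also one of them.) -/
def hullFaces (V : Set E3) : Set (Set E3) :=
  {F | F.Nonempty ∧ IsExposed ℝ (convexHull ℝ V) F ∧ Module.finrank ℝ (vectorSpan ℝ F) ≤ 2}

/-- The convex hull of a finite set has finitely many faces, so the counts below are genuine. -/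
theorem hullFaces_finite {V : Set E3} (hV : V.Finite) : (hullFaces V).Finite := by
  have hc : IsCompact (convexHull ℝ V) := hV.isCompact_convexHull (𝕜 := ℝ)
  have key : ∀ F ∈ hullFaces V, F.extremePoints ℝ ⊆ V ∧
      closure (convexHull ℝ (F.extremePoints ℝ)) = F := by
    rintro F ⟨-, hF, -⟩
    refine ⟨hF.isExtreme.extremePoints_subset_extremePoints.trans
      extremePoints_convexHull_subset, ?_⟩
    exact closure_convexHull_extremePoints (hF.isCompact hc) (hF.convex (convex_convexHull ℝ V))
  refine Set.Finite.of_finite_image (f := fun F => F.extremePoints ℝ)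
    (hV.finite_subsets.subset ?_) ?_
  · rintro _ ⟨F, hF, rfl⟩
    exact (key F hF).1
  · intro F hF G hG h
    rw [← (key F hF).2, ← (key G hG).2]
    exact congrArg (fun s => closure (convexHull ℝ s)) h

/-- The number of structural changes when the point set `V` is replaced by `W`: hull features
created plus hull features destroyed. -/
def structuralChanges (V W : Set E3) : ℕ :=
  (hullFaces W \ hullFaces V).ncard + (hullFaces V \ hullFaces W).ncard

/-- The total number of structural changes when the points of the list `L` are inserted one by
one, starting from the empty set. -/
def totalChanges (L : List E3) : ℕ :=
  ∑ t ∈ Finset.range L.length, structuralChanges {p | p ∈ L.take t} {p | p ∈ L.take (t + 1)}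

section Order

open scoped Classical

variable {κ : Type*}

/-- The set of colors that occur in `S`. -/
def colors (S : Finset E3) (color : E3 → κ) : Finset κ := S.image color

/-- The class of all points of `S` that have color `a`. -/
def colorClass (S : Finset E3) (color : E3 → κ) (a : κ) : Finset E3 :=
  S.filter fun p => color p = a

/-- The sample space: an ordering of the color classes, together with an ordering of the points
inside each class. The random experiment draws a uniform element of it, i.e. all these orderings
are independent and uniform. -/
abbrev Orders (S : Finset E3) (color : E3 → κ) : Type _ :=
  (Fin (colors S color).card ≃ {a // a ∈ colors S color}) ×
    ((a : {a // a ∈ colors S color}) →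
      (Fin (colorClass S color a).card ≃ {p // p ∈ colorClass S color a}))

instance (S : Finset E3) (color : E3 → κ) : Nonempty (Orders S color) :=
  ⟨((colors S color).equivFin.symm, fun a => (colorClass S color a).equivFin.symm)⟩

/-- The order of insertion: the classes in the chosen order, and inside each class its points in
the order chosen for that class. -/
def insertionOrder (S : Finset E3) (color : E3 → κ) (ω : Orders S color) : List E3 :=
  (List.ofFn ω.1).flatMap fun a => List.ofFn fun j => (ω.2 a j : E3)

/-- The expected total number of structural changes: the average over all elements of the sample
space. -/
def expectedChanges (S : Finset E3) (color : E3 → κ) : ℝ :=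
  (∑ ω : Orders S color, (totalChanges (insertionOrder S color ω) : ℝ)) /
    (Fintype.card (Orders S color) : ℝ)

end Order

end ColoredHull

end

/-! Upper bound. Every destroyed face was created earlier, so up to a factor 2 only creations count.
A face created by inserting `p` contains `p`, and there are at most `3 * deg p + 2` of these, where
`deg p` is the number of hull edges at `p` (`createdFaces_insert_le`). It remains to bound the
expected degree of the inserted point.

Backward analysis inside a class `a`: the last of its first `k + 1` points is uniform among them.
Its expected degree is therefore `1 / (k + 1)` times the total degree of this prefix `J a` in the
hull of the earlier classes and `J a`. Backward analysis over the classes: among the first classes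
`R`, the last one is uniform. Hence it suffices that, summed over `a ∈ R`, the degrees of `J a` in
the hull of `J a` and the other classes of `R` are linear in the number of points
(`sum_edgeDegree_lastClass_le`). This is a sampling argument: cut a random set of classes down to
their prefixes and keep the others whole. Each counted edge survives with probability at least 1/4,
and the sample has linearly many edges. So each `k` contributes `O(n / (k + 1))`, and the harmonic
sum gives the logarithm.

The linear edge bound `card_edges_le` comes from a sweep over supporting functionals, which needs
neither Euler's formula nor general position.

Lower bound. Two classes lie on parallel parabolas. When `p` is inserted in the last class, each
point of the other parabola that has `p` as its nearest point so far spans a new face with `p`. By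
backward analysis the `(k + 1)`-st point of the last class gets on average at least a share `1 / (k
+ 1)` of the other class. -/

noncomputable section

namespace ColoredHull

open scoped Classical

/-! ### Linear bound on upper edges by a sweep. -/

section Sweep

variable {α : Type*}

/-- The points that are the unique maximum of `a * x + b * y + z` on `V` for some `b`. -/
def sweepActive (V : Finset α) (x y z : α → ℝ) (a : ℝ) (r : α) : Prop :=
  r ∈ V ∧ ∃ b : ℝ, ∀ s ∈ V, s ≠ r → a * x s + b * y s + z s < a * x r + b * y r + z r

/-- `p` and `q` are consecutive (in the order given by `y`) active points at `a`. -/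
def sweepConsecutive (V : Finset α) (x y z : α → ℝ) (a : ℝ) (p q : α) : Prop :=
  sweepActive V x y z a p ∧ sweepActive V x y z a q ∧ y p < y q ∧
    ∀ r, sweepActive V x y z a r → y r ≤ y p ∨ y q ≤ y r

/-- The pairs at which `a * x + b * y + z` attains its maximum on `V`, for some `a` and `b`. -/
def IsUpperEdge (V : Finset α) (x y z : α → ℝ) (p q : α) : Prop :=
  p ∈ V ∧ q ∈ V ∧ y p < y q ∧ ∃ a b : ℝ, a * x p + b * y p + z p = a * x q + b * y q + z q ∧
    ∀ r ∈ V, r ≠ p → r ≠ q → a * x r + b * y r + z r < a * x p + b * y p + z p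

/-- Continuity at 0. This is what allows a supporting functional to be tilted without losing its
finitely many strict inequalities. -/
theorem exists_pos_forall_add_mul_neg (s : Finset α) (f g : α → ℝ) (h : ∀ v ∈ s, f v < 0) :
    ∃ ε : ℝ, 0 < ε ∧ ∀ v ∈ s, f v + ε * g v < 0 := by
  have key : ∀ᶠ ε in nhds (0 : ℝ), ∀ v ∈ s, f v + ε * g v < 0 := by
    rw [Filter.eventually_all_finset]
    intro v hv
    have hc : ContinuousAt (fun ε : ℝ => f v + ε * g v) 0 := by fun_prop
    exact hc.eventually_lt_const (by simpa using h v hv)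
  have h2 : ∀ᶠ ε in nhdsWithin (0 : ℝ) (Set.Ioi 0), 0 < ε ∧ ∀ v ∈ s, f v + ε * g v < 0 :=
    (eventually_mem_nhdsWithin).and (key.filter_mono nhdsWithin_le_nhds)
  exact h2.exists

variable {V : Finset α} {x y z : α → ℝ}

/-- The strict inequalities are affine in the two coefficients jointly, so the two witnesses
interpolate. Thus a point starts and stops being active at most once during the sweep. -/
theorem sweepActive.convex {a b c : ℝ} {r : α} (ha : sweepActive V x y z a r)
    (hc : sweepActive V x y z c r) (hab : a ≤ b) (hbc : b ≤ c) : sweepActive V x y z b r := by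
  obtain ⟨hr, b₁, h₁⟩ := ha
  obtain ⟨-, b₂, h₂⟩ := hc
  refine ⟨hr, ?_⟩
  have hb : b ∈ segment ℝ a c := by rw [segment_eq_Icc (hab.trans hbc)]; exact ⟨hab, hbc⟩
  obtain ⟨s, t, hs, ht, hst, rfl⟩ := hb
  refine ⟨s * b₁ + t * b₂, fun v hv hvr => ?_⟩
  have e₁ := h₁ v hv hvr
  have e₂ := h₂ v hv hvr
  obtain rfl : t = 1 - s := by linarith
  simp only [smul_eq_mul]
  rcases hs.eq_or_lt with rfl | hs
  · simpa using e₂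
  · nlinarith [mul_lt_mul_of_pos_left e₁ hs, mul_le_mul_of_nonneg_left e₂.le ht]

/-- Tilting `b` slightly down or up makes `p` or `q` the unique maximum. A point strictly between
them in the `y` order is below both at `b`; for larger coefficients of `y` it loses to `q`, for
smaller ones to `p`. -/
theorem IsUpperEdge.exists_consecutive {p q : α} (h : IsUpperEdge V x y z p q) :
    ∃ a, sweepConsecutive V x y z a p q := by
  obtain ⟨hp, hq, hpq, a, b, heq, hlt⟩ := h
  have hne : p ≠ q := fun e => by simp [e] at hpq
  have hlt' : ∀ v ∈ (V.erase p).erase q,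
      (a * x v + b * y v + z v) - (a * x p + b * y p + z p) < 0 := by
    intro v hv
    simp only [Finset.mem_erase] at hv
    linarith [hlt v hv.2.2 hv.2.1 hv.1]
  refine ⟨a, ⟨hp, ?_⟩, ⟨hq, ?_⟩, hpq, ?_⟩
  · obtain ⟨ε, hε, h⟩ := exists_pos_forall_add_mul_neg _ _ (fun v => -(y v - y p)) hlt'
    refine ⟨b - ε, fun s hs hsp => ?_⟩
    by_cases hsq : s = q
    · subst hsq
      nlinarith
    · have := h s (by simp [hs, hsp, hsq])
      nlinarith
  · obtain ⟨ε, hε, h⟩ := exists_pos_forall_add_mul_neg _ _ (fun v => (y v - y q)) hlt'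
    refine ⟨b + ε, fun s hs hsq => ?_⟩
    by_cases hsp : s = p
    · subst hsp
      nlinarith
    · have := h s (by simp [hs, hsp, hsq])
      nlinarith
  · rintro r ⟨hr, b', h'⟩
    by_contra! hcon
    have hrp : r ≠ p := fun e => by simp [e] at hcon
    have hrq : r ≠ q := fun e => by simp [e] at hcon
    have e₁ := h' p hp hrp.symm
    have e₂ := h' q hq hrq.symm
    have e₃ := hlt r hr hrp hrq
    rcases le_total b b' with hb | hb
    · nlinarith [mul_le_mul_of_nonneg_left hcon.2.le (sub_nonneg.2 hb)]
    · nlinarith [mul_le_mul_of_nonneg_left hcon.1.le (sub_nonneg.2 hb)]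

theorem sweepConsecutive.right_unique {a : ℝ} {p q q' : α} (hy : Set.InjOn y V)
    (h : sweepConsecutive V x y z a p q) (h' : sweepConsecutive V x y z a p q') : q = q' := by
  have h1 := h.2.2.2 q' h'.2.1
  have h2 := h'.2.2.2 q h.2.1
  have e := h.2.2.1
  have e' := h'.2.2.1
  refine hy h.2.1.1 h'.2.1.1 (le_antisymm ?_ ?_)
  · exact h1.resolve_left (not_le.2 e')
  · exact h2.resolve_left (not_le.2 e)

theorem sweepConsecutive.left_unique {a : ℝ} {p p' q : α} (hy : Set.InjOn y V)
    (h : sweepConsecutive V x y z a p q) (h' : sweepConsecutive V x y z a p' q) : p = p' := by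
  have h1 := h.2.2.2 p' h'.1
  have h2 := h'.2.2.2 p h.1
  have e := h.2.2.1
  have e' := h'.2.2.1
  refine hy h.1.1 h'.1.1 (le_antisymm ?_ ?_)
  · exact h2.resolve_right (not_le.2 e)
  · exact h1.resolve_right (not_le.2 e')

theorem sweepConsecutive.eq_of_between {a : ℝ} {p q p' q' r : α} (hy : Set.InjOn y V)
    (h : sweepConsecutive V x y z a p q) (h' : sweepConsecutive V x y z a p' q')
    (hp : y p < y r) (hq : y r < y q) (hp' : y p' < y r) (hq' : y r < y q') :
    p = p' ∧ q = q' := by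
  have hpp : p = p' := by
    refine hy h.1.1 h'.1.1 (le_antisymm ?_ ?_)
    · exact (h'.2.2.2 p h.1).resolve_right (not_le.2 (hp.trans hq'))
    · exact (h.2.2.2 p' h'.1).resolve_right (not_le.2 (hp'.trans hq))
  subst hpp
  exact ⟨rfl, h.right_unique hy h'⟩

/-- How a pair of consecutive points comes into being at `t`, after the earlier sample `t'`. -/
theorem sweepConsecutive.cases_of_not {t t' : ℝ} {p q : α}
    (h : sweepConsecutive V x y z t p q) (h' : ¬ sweepConsecutive V x y z t' p q) :
    ¬ sweepActive V x y z t' p ∨ ¬ sweepActive V x y z t' q ∨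
      ∃ r, sweepActive V x y z t' r ∧ ¬ sweepActive V x y z t r ∧ y p < y r ∧ y r < y q := by
  by_contra! hcon
  obtain ⟨h1, h2, h3⟩ := hcon
  refine h' ⟨h1, h2, h.2.2.1, fun r hr => ?_⟩
  by_contra! hr'
  by_cases hrt : sweepActive V x y z t r
  · exact (h.2.2.2 r hrt).elim (not_le.2 hr'.1) (not_le.2 hr'.2)
  · exact absurd hr'.2 (not_lt.2 (h3 r hr hrt hr'.1))

/-- Charging over finitely many samples, one per edge. When a pair first becomes consecutive, either
this is the first sample (`E₀`), or one of its points has just become active (`E₁`, `E₂`), or a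
point between them has just ceased to be (`E₃`). Since activity is an interval, the charged point
fixes the sample, and then the pair; each of the four kinds occurs at most `V.card` times. -/
theorem card_upperEdges_le (hy : Set.InjOn y V) :
    ((V ×ˢ V).filter fun e => IsUpperEdge V x y z e.1 e.2).card ≤ 4 * V.card := by
  set E := (V ×ˢ V).filter fun e => IsUpperEdge V x y z e.1 e.2 with hE
  have hex : ∀ e : α × α, ∃ a : ℝ, e ∈ E → sweepConsecutive V x y z a e.1 e.2 := by
    intro e
    by_cases he : e ∈ E
    · obtain ⟨a, ha⟩ := (Finset.mem_filter.1 he).2.exists_consecutive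
      exact ⟨a, fun _ => ha⟩
    · exact ⟨0, fun h => absurd h he⟩
  choose w hw using hex
  set T := E.image w with hT
  -- the first sample at which a pair is consecutive
  have hfirst : ∀ e : α × α, ∃ t : ℝ, e ∈ E → t ∈ T ∧ sweepConsecutive V x y z t e.1 e.2 ∧
      ∀ s ∈ T, s < t → ¬ sweepConsecutive V x y z s e.1 e.2 := by
    intro e
    by_cases he : e ∈ E
    · have hne : (T.filter fun t => sweepConsecutive V x y z t e.1 e.2).Nonempty :=
        ⟨w e, Finset.mem_filter.2 ⟨Finset.mem_image_of_mem _ he, hw e he⟩⟩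
      obtain ⟨t, ht, hmin⟩ := Finset.exists_min_image _ id hne
      refine ⟨t, fun _ => ⟨(Finset.mem_filter.1 ht).1, (Finset.mem_filter.1 ht).2, ?_⟩⟩
      intro s hs hst hcon
      exact absurd (hmin s (Finset.mem_filter.2 ⟨hs, hcon⟩)) (not_le.2 hst)
    · exact ⟨0, fun h => absurd h he⟩
  choose τ hτ using hfirst
  -- the sample before it
  have hpred : ∀ e : α × α, ∃ s : ℝ, e ∈ E → (∃ u ∈ T, u < τ e) →
      s ∈ T ∧ s < τ e ∧ ∀ u ∈ T, u < τ e → u ≤ s := by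
    intro e
    by_cases he : ∃ u ∈ T, u < τ e
    · have hne : (T.filter fun u => u < τ e).Nonempty := by
        obtain ⟨u, hu, hlt⟩ := he
        exact ⟨u, Finset.mem_filter.2 ⟨hu, hlt⟩⟩
      obtain ⟨s, hs, hmax⟩ := Finset.exists_max_image _ id hne
      refine ⟨s, fun _ _ => ⟨(Finset.mem_filter.1 hs).1, (Finset.mem_filter.1 hs).2, ?_⟩⟩
      exact fun u hu hlt => hmax u (Finset.mem_filter.2 ⟨hu, hlt⟩)
    · exact ⟨0, fun _ h => absurd h he⟩
  choose π hπ using hpred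
  set E₀ := E.filter fun e => ¬ ∃ u ∈ T, u < τ e
  set E₁ := E.filter fun e => (∃ u ∈ T, u < τ e) ∧ ¬ sweepActive V x y z (π e) e.1
  set E₂ := E.filter fun e => (∃ u ∈ T, u < τ e) ∧ ¬ sweepActive V x y z (π e) e.2
  set E₃ := E.filter fun e => (∃ u ∈ T, u < τ e) ∧ ∃ r, sweepActive V x y z (π e) r ∧
    ¬ sweepActive V x y z (τ e) r ∧ y e.1 < y r ∧ y r < y e.2
  have hcover : E ⊆ E₀ ∪ E₁ ∪ E₂ ∪ E₃ := by
    intro e he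
    by_cases hu : ∃ u ∈ T, u < τ e
    · have hp := hπ e he hu
      rcases (hτ e he).2.1.cases_of_not ((hτ e he).2.2 _ hp.1 hp.2.1) with h | h | h
      · simp only [Finset.mem_union]
        exact Or.inl (Or.inl (Or.inr (Finset.mem_filter.2 ⟨he, hu, h⟩)))
      · simp only [Finset.mem_union]
        exact Or.inl (Or.inr (Finset.mem_filter.2 ⟨he, hu, h⟩))
      · exact Finset.mem_union_right _ (Finset.mem_filter.2 ⟨he, hu, h⟩)
    · simp only [Finset.mem_union]
      exact Or.inl (Or.inl (Or.inl (Finset.mem_filter.2 ⟨he, hu⟩)))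
  have hV : ∀ e ∈ E, e.1 ∈ V ∧ e.2 ∈ V := fun e he =>
    Finset.mem_product.1 (Finset.mem_filter.1 he).1
  have hle : ∀ e ∈ E, ∀ e' ∈ E, τ e < τ e' → (∃ u ∈ T, u < τ e') → τ e ≤ π e' :=
    fun e he e' he' h hu => (hπ e' he' hu).2.2 _ (hτ e he).1 h
  have h₀ : E₀.card ≤ V.card := by
    refine Finset.card_le_card_of_injOn Prod.fst
      (fun e he => (hV e (Finset.mem_filter.1 he).1).1) ?_
    intro e he e' he' heq
    obtain ⟨he, hu⟩ := Finset.mem_filter.1 he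
    obtain ⟨he', hu'⟩ := Finset.mem_filter.1 he'
    push Not at hu hu'
    have ht : τ e = τ e' := le_antisymm (hu _ (hτ e' he').1) (hu' _ (hτ e he).1)
    have h1 := (hτ e he).2.1
    have h2 := (hτ e' he').2.1
    rw [← ht, ← heq] at h2
    exact Prod.ext heq (h1.right_unique hy h2)
  have h₁ : E₁.card ≤ V.card := by
    refine Finset.card_le_card_of_injOn Prod.fst
      (fun e he => (hV e (Finset.mem_filter.1 he).1).1) ?_
    have key : ∀ e ∈ E₁, ∀ e' ∈ E₁, e.1 = e'.1 → ¬ τ e < τ e' := by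
      intro e he e' he' heq hlt
      obtain ⟨he, hu, -⟩ := Finset.mem_filter.1 he
      obtain ⟨he', hu', hna⟩ := Finset.mem_filter.1 he'
      refine hna (sweepActive.convex ?_ (hτ e' he').2.1.1 (hle e he e' he' hlt hu')
        (hπ e' he' hu').2.1.le)
      rw [← heq]
      exact (hτ e he).2.1.1
    intro e he e' he' heq
    have ht : τ e = τ e' :=
      le_antisymm (not_lt.1 (key e' he' e he heq.symm)) (not_lt.1 (key e he e' he' heq))
    have h1 := (hτ e (Finset.mem_filter.1 he).1).2.1
    have h2 := (hτ e' (Finset.mem_filter.1 he').1).2.1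
    rw [← ht, ← heq] at h2
    exact Prod.ext heq (h1.right_unique hy h2)
  have h₂ : E₂.card ≤ V.card := by
    refine Finset.card_le_card_of_injOn Prod.snd
      (fun e he => (hV e (Finset.mem_filter.1 he).1).2) ?_
    have key : ∀ e ∈ E₂, ∀ e' ∈ E₂, e.2 = e'.2 → ¬ τ e < τ e' := by
      intro e he e' he' heq hlt
      obtain ⟨he, hu, -⟩ := Finset.mem_filter.1 he
      obtain ⟨he', hu', hna⟩ := Finset.mem_filter.1 he'
      refine hna (sweepActive.convex ?_ (hτ e' he').2.1.2.1 (hle e he e' he' hlt hu')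
        (hπ e' he' hu').2.1.le)
      rw [← heq]
      exact (hτ e he).2.1.2.1
    intro e he e' he' heq
    have ht : τ e = τ e' :=
      le_antisymm (not_lt.1 (key e' he' e he heq.symm)) (not_lt.1 (key e he e' he' heq))
    have h1 := (hτ e (Finset.mem_filter.1 he).1).2.1
    have h2 := (hτ e' (Finset.mem_filter.1 he').1).2.1
    rw [← ht, ← heq] at h2
    exact Prod.ext (h1.left_unique hy h2) heq
  have h₃ : E₃.card ≤ V.card := by
    have hex : ∀ e : α × α, ∃ r, e ∈ E₃ → sweepActive V x y z (π e) r ∧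
        ¬ sweepActive V x y z (τ e) r ∧ y e.1 < y r ∧ y r < y e.2 := by
      intro e
      by_cases he : e ∈ E₃
      · obtain ⟨r, hr⟩ := (Finset.mem_filter.1 he).2.2
        exact ⟨r, fun _ => hr⟩
      · exact ⟨e.1, fun h => absurd h he⟩
    choose ρ hρ using hex
    refine Finset.card_le_card_of_injOn ρ (fun e he => (hρ e he).1.1) ?_
    have key : ∀ e ∈ E₃, ∀ e' ∈ E₃, ρ e = ρ e' → ¬ τ e < τ e' := by
      intro e he e' he' heq hlt
      have hr := hρ e he
      have hr' := hρ e' he'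
      obtain ⟨he, hu, -⟩ := Finset.mem_filter.1 he
      obtain ⟨he', hu', -⟩ := Finset.mem_filter.1 he'
      rw [← heq] at hr'
      exact hr.2.1 (hr.1.convex hr'.1 (hπ e he hu).2.1.le (hle e he e' he' hlt hu'))
    intro e he e' he' heq
    have ht : τ e = τ e' :=
      le_antisymm (not_lt.1 (key e' he' e he heq.symm)) (not_lt.1 (key e he e' he' heq))
    have h1 := (hτ e (Finset.mem_filter.1 he).1).2.1
    have h2 := (hτ e' (Finset.mem_filter.1 he').1).2.1
    have hr := hρ e he
    have hr' := hρ e' he'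
    rw [← heq] at hr'
    rw [← ht] at h2
    obtain ⟨e1, e2⟩ := h1.eq_of_between hy h2 hr.2.2.1 hr.2.2.2 hr'.2.2.1 hr'.2.2.2
    exact Prod.ext e1 e2
  have := Finset.card_le_card hcover
  have u₁ := Finset.card_union_le (E₀ ∪ E₁ ∪ E₂) E₃
  have u₂ := Finset.card_union_le (E₀ ∪ E₁) E₂
  have u₃ := Finset.card_union_le E₀ E₁
  omega

end Sweep

/-! ### Edges of a hull in space. -/

/-- The segment from `p` to `q` is an exposed edge of the convex hull of `V`. -/
def IsEdge (V : Finset E3) (p q : E3) : Prop :=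
  p ∈ V ∧ q ∈ V ∧ p ≠ q ∧ ∃ l : E3 →ₗ[ℝ] ℝ, l p = l q ∧
    ∀ v ∈ V, l v ≤ l p ∧ (l v = l p → v ∈ segment ℝ p q)

theorem IsEdge.symm {V : Finset E3} {p q : E3} (h : IsEdge V p q) : IsEdge V q p := by
  obtain ⟨hp, hq, hne, l, hl, h⟩ := h
  refine ⟨hq, hp, hne.symm, l, hl.symm, fun v hv => ?_⟩
  rw [← hl, segment_symm]
  exact h v hv

theorem IsEdge.mono {V W : Finset E3} {p q : E3} (h : IsEdge V p q) (hW : W ⊆ V) (hp : p ∈ W)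
    (hq : q ∈ W) : IsEdge W p q := by
  obtain ⟨-, -, hne, l, hl, h⟩ := h
  exact ⟨hp, hq, hne, l, hl, fun v hv => h v (hW hv)⟩

/-- An endpoint of an edge is an extreme point. -/
theorem IsEdge.eq_or_eq_of_mem_segment {V : Finset E3} {p q r s : E3} (h : IsEdge V r s)
    (hp : p ∈ V) (hq : q ∈ V) (hr : r ∈ segment ℝ p q) : r = p ∨ r = q := by
  obtain ⟨-, -, hne, l, hl, h⟩ := h
  obtain ⟨a, b, ha, hb, hab, hr⟩ := hr
  rcases ha.eq_or_lt with rfl | ha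
  · right
    rw [zero_add] at hab
    rw [← hr, hab]
    simp
  rcases hb.eq_or_lt with rfl | hb
  · left
    rw [add_zero] at hab
    rw [← hr, hab]
    simp
  left
  have hlr : l r = a * l p + b * l q := by rw [← hr]; simp
  have hp1 := (h p hp).1
  have hq1 := (h q hq).1
  obtain rfl : b = 1 - a := by linarith
  have hlp : l p = l r := by
    refine le_antisymm hp1 ?_
    by_contra! hcon
    nlinarith [mul_lt_mul_of_pos_left hcon ha, mul_le_mul_of_nonneg_left hq1 hb.le]
  have hlq : l q = l r := by
    refine le_antisymm hq1 ?_
    by_contra! hcon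
    nlinarith [mul_lt_mul_of_pos_left hcon hb, mul_le_mul_of_nonneg_left hp1 ha.le]
  have hps := (h p hp).2 hlp
  have hqs := (h q hq).2 hlq
  rw [segment_eq_image'] at hps hqs
  obtain ⟨t, ⟨ht, -⟩, rfl⟩ := hps
  obtain ⟨t', ⟨ht', -⟩, rfl⟩ := hqs
  have hz : (a * t + (1 - a) * t') • (s - r) = 0 := by
    have : a • (r + t • (s - r)) + (1 - a) • (r + t' • (s - r)) =
      r + (a * t + (1 - a) * t') • (s - r) := by module
    rw [this] at hr
    simpa using hr
  have hz' : a * t + (1 - a) * t' = 0 :=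
    (smul_eq_zero.1 hz).resolve_right (sub_ne_zero.2 hne.symm)
  have ht0 : t = 0 := by
    have h1 := mul_nonneg ha.le ht
    have h2 := mul_nonneg hb.le ht'
    have h3 : a * t = 0 := by linarith
    exact (mul_eq_zero.1 h3).resolve_left ha.ne'
  simp [ht0]

/-- A nonzero functional on space is a member of a spanning triple of functionals. -/
theorem exists_spanning_functionals {m : E3 →ₗ[ℝ] ℝ} (hm : m ≠ 0) :
    ∃ f g : E3 →ₗ[ℝ] ℝ, ∀ l : E3 →ₗ[ℝ] ℝ, ∃ a b c : ℝ, ∀ v, l v = a * m v + b * f v + c * g v := by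
  have hcoord : ∀ (l : E3 →ₗ[ℝ] ℝ) (v : E3), l v = v 0 * l (EuclideanSpace.single 0 1) +
      v 1 * l (EuclideanSpace.single 1 1) + v 2 * l (EuclideanSpace.single 2 1) := by
    intro l v
    have hv : v = v 0 • EuclideanSpace.single 0 1 + v 1 • EuclideanSpace.single 1 1 +
        v 2 • EuclideanSpace.single (2 : Fin 3) (1 : ℝ) := by
      ext i
      fin_cases i <;> simp
    conv_lhs => rw [hv]
    simp only [map_add, map_smul, smul_eq_mul]
  let π : Fin 3 → E3 →ₗ[ℝ] ℝ := fun i => (EuclideanSpace.proj i : E3 →L[ℝ] ℝ).toLinearMap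
  have hπ : ∀ i v, π i v = v i := fun i v => rfl
  have hne : m (EuclideanSpace.single 0 1) ≠ 0 ∨ m (EuclideanSpace.single 1 1) ≠ 0 ∨
      m (EuclideanSpace.single 2 1) ≠ 0 := by
    by_contra! hcon
    refine hm (LinearMap.ext fun v => ?_)
    rw [hcoord m v, hcon.1, hcon.2.1, hcon.2.2]
    simp
  rcases hne with h | h | h
  · refine ⟨π 1, π 2, fun l => ⟨l (EuclideanSpace.single 0 1) / m (EuclideanSpace.single 0 1),
      l (EuclideanSpace.single 1 1) - l (EuclideanSpace.single 0 1) /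
        m (EuclideanSpace.single 0 1) * m (EuclideanSpace.single 1 1),
      l (EuclideanSpace.single 2 1) - l (EuclideanSpace.single 0 1) /
        m (EuclideanSpace.single 0 1) * m (EuclideanSpace.single 2 1), fun v => ?_⟩⟩
    rw [hcoord l v, hcoord m v, hπ, hπ]
    field_simp
    ring
  · refine ⟨π 0, π 2, fun l => ⟨l (EuclideanSpace.single 1 1) / m (EuclideanSpace.single 1 1),
      l (EuclideanSpace.single 0 1) - l (EuclideanSpace.single 1 1) /
        m (EuclideanSpace.single 1 1) * m (EuclideanSpace.single 0 1),
      l (EuclideanSpace.single 2 1) - l (EuclideanSpace.single 1 1) /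
        m (EuclideanSpace.single 1 1) * m (EuclideanSpace.single 2 1), fun v => ?_⟩⟩
    rw [hcoord l v, hcoord m v, hπ, hπ]
    field_simp
    ring
  · refine ⟨π 0, π 1, fun l => ⟨l (EuclideanSpace.single 2 1) / m (EuclideanSpace.single 2 1),
      l (EuclideanSpace.single 0 1) - l (EuclideanSpace.single 2 1) /
        m (EuclideanSpace.single 2 1) * m (EuclideanSpace.single 0 1),
      l (EuclideanSpace.single 1 1) - l (EuclideanSpace.single 2 1) /
        m (EuclideanSpace.single 2 1) * m (EuclideanSpace.single 1 1), fun v => ?_⟩⟩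
    rw [hcoord l v, hcoord m v, hπ, hπ]
    field_simp
    ring

theorem exists_functional_injOn (V : Finset E3) :
    ∃ y : E3 →ₗ[ℝ] ℝ, Set.InjOn y V := by
  obtain ⟨f, hf⟩ := Module.exists_dual_forall_apply_ne_zero (K := ℝ)
    (fun e : {e : V × V // e.1 ≠ e.2} => (e.1.1 : E3) - (e.1.2 : E3))
    (fun e => sub_ne_zero.2 fun h => e.2 (Subtype.ext h))
  refine ⟨f, fun p hp q hq hpq => ?_⟩
  by_contra hne
  refine hf ⟨(⟨p, hp⟩, ⟨q, hq⟩), fun h => hne (congrArg Subtype.val h)⟩ ?_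
  simp [hpq]

/-- The number of edges, counted with orientation, is linear in the number of points. -/
theorem card_edges_le (V : Finset E3) :
    ((V ×ˢ V).filter fun e => IsEdge V e.1 e.2).card ≤ 16 * V.card := by
  obtain ⟨y, hy⟩ := exists_functional_injOn V
  set E := (V ×ˢ V).filter fun e => IsEdge V e.1 e.2 with hE
  rcases E.eq_empty_or_nonempty with hemp | ⟨⟨p₀, q₀⟩, hpq₀⟩
  · simp [hemp]
  have hpq₀ := (Finset.mem_filter.1 hpq₀).2
  have hy0 : y ≠ 0 := by
    rintro rfl
    exact hpq₀.2.2.1 (hy hpq₀.1 hpq₀.2.1 rfl)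
  obtain ⟨x, z, hspan⟩ := exists_spanning_functionals hy0
  -- Points of `V` in the interior of an edge would attain the same maximum. Endpoints of edges are
  -- extreme, so over `U` the maximum is attained at `p` and `q` alone.
  set U := V.filter fun p => ∃ q, IsEdge V p q with hU
  have hUV : U ⊆ V := Finset.filter_subset _ _
  have hyU : Set.InjOn y U := hy.mono (by exact_mod_cast hUV)
  have key : ∀ p q, IsEdge V p q → y p < y q →
      IsUpperEdge U x y z p q ∨ IsUpperEdge U x y (fun v => - z v) p q := by
    intro p q hpq hlt
    have hpU : p ∈ U := Finset.mem_filter.2 ⟨hpq.1, q, hpq⟩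
    have hqU : q ∈ U := Finset.mem_filter.2 ⟨hpq.2.1, p, hpq.symm⟩
    obtain ⟨a, b, c, hc, heq, hmax⟩ : ∃ a b c : ℝ, c ≠ 0 ∧
        a * x p + b * y p + c * z p = a * x q + b * y q + c * z q ∧
        ∀ r ∈ U, r ≠ p → r ≠ q →
          a * x r + b * y r + c * z r < a * x p + b * y p + c * z p := by
      obtain ⟨hp, hq, hne, l, hl, hmax⟩ := hpq
      obtain ⟨b, a, c, hl'⟩ := hspan l
      have hstrict : ∀ r ∈ (U.erase p).erase q, l r - l p < 0 := by
        intro r hr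
        simp only [Finset.mem_erase] at hr
        obtain ⟨hrq, hrp, hrU⟩ := hr
        obtain ⟨hrV, s, hrs⟩ := Finset.mem_filter.1 hrU
        have h := hmax r hrV
        refine sub_neg.2 (lt_of_le_of_ne h.1 fun he => ?_)
        exact (hrs.eq_or_eq_of_mem_segment hp hq (h.2 he)).elim hrp hrq
      -- The sweep needs a nonzero coefficient of `z`. If it vanishes, a small multiple of `z - lam
      -- * y` is added, with `lam` chosen to keep the values at `p` and `q` equal.
      by_cases hc : c = 0
      · have hyne : y p - y q ≠ 0 := by linarith
        set lam := (z p - z q) / (y p - y q) with hlam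
        have hlam' : lam * (y p - y q) = z p - z q := by rw [hlam]; field_simp
        obtain ⟨ε, hε, h⟩ := exists_pos_forall_add_mul_neg _ _
          (fun v => (z v - z p) - lam * (y v - y p)) hstrict
        refine ⟨a, b - ε * lam, ε, hε.ne', ?_, ?_⟩
        · rw [hl' p, hl' q, hc] at hl
          linear_combination hl - ε * hlam'
        · intro r hr hrp hrq
          have := h r (by simp [hr, hrp, hrq])
          simp only [hl', hc] at this
          nlinarith
      · refine ⟨a, b, c, hc, ?_, ?_⟩
        · rw [hl' p, hl' q] at hl
          linarith
        · intro r hr hrp hrq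
          have := hstrict r (by simp [hr, hrp, hrq])
          rw [hl', hl'] at this
          linarith
    rcases lt_or_gt_of_ne hc with hc | hc
    · right
      refine ⟨hpU, hqU, hlt, a / (-c), b / (-c), ?_, fun r hr hrp hrq => ?_⟩
      · field_simp
        linarith
      · have h := hmax r hr hrp hrq
        have hc' : 0 < -c := by linarith
        have e : ∀ v, a / (-c) * x v + b / (-c) * y v + - z v =
            (a * x v + b * y v + c * z v) / (-c) := by
          intro v
          field_simp
          ring
        rw [e, e]
        gcongr
    · left
      refine ⟨hpU, hqU, hlt, a / c, b / c, ?_, fun r hr hrp hrq => ?_⟩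
      · field_simp
        linarith
      · have h := hmax r hr hrp hrq
        have e : ∀ v, a / c * x v + b / c * y v + z v =
            (a * x v + b * y v + c * z v) / c := by
          intro v
          field_simp
        rw [e, e]
        gcongr
  set F₁ := (U ×ˢ U).filter fun e => IsUpperEdge U x y z e.1 e.2
  set F₂ := (U ×ˢ U).filter fun e => IsUpperEdge U x y (fun v => - z v) e.1 e.2
  have hF₁ : F₁.card ≤ 4 * U.card := card_upperEdges_le hyU
  have hF₂ : F₂.card ≤ 4 * U.card := card_upperEdges_le hyU
  have hUc : U.card ≤ V.card := Finset.card_le_card hUV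
  have hF : ∀ p q, IsEdge V p q → y p < y q → (p, q) ∈ F₁ ∪ F₂ := by
    intro p q hpq hlt
    rw [Finset.mem_union]
    refine (key p q hpq hlt).imp (fun h => ?_) (fun h => ?_) <;>
      exact Finset.mem_filter.2 ⟨Finset.mem_product.2 ⟨h.1, h.2.1⟩, h⟩
  have hsub : E ⊆ (F₁ ∪ F₂) ∪ (F₁ ∪ F₂).image Prod.swap := by
    rintro ⟨p, q⟩ he
    have he := (Finset.mem_filter.1 he).2
    rw [Finset.mem_union]
    have hne : y p ≠ y q := fun h => he.2.2.1 (hy he.1 he.2.1 h)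
    rcases lt_or_gt_of_ne hne with h | h
    · exact Or.inl (hF p q he h)
    · exact Or.inr (Finset.mem_image.2 ⟨(q, p), hF q p he.symm h, rfl⟩)
  -- The constant 16 is 4 for the sweep, times two signs of `z`, times two orientations.
  have h1 := Finset.card_le_card hsub
  have h2 := Finset.card_union_le (F₁ ∪ F₂) ((F₁ ∪ F₂).image Prod.swap)
  have h3 : ((F₁ ∪ F₂).image Prod.swap).card ≤ (F₁ ∪ F₂).card := Finset.card_image_le
  have h4 := Finset.card_union_le F₁ F₂
  omega

/-! ### Faces at a vertex, counted in the vertex figure. -/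

/-- A finite planar point set has at most three times as many contact sets with supporting lines
as it has vertices, up to two. The map `g` is the first coordinate and `R` contains the first
coordinates of the rightmost points of the contact sets. -/
theorem card_contactSets_le {α : Type*} (V : Finset α) (g h : α → ℝ)
    (hgh : ∀ u ∈ V, ∀ v ∈ V, g u = g v → h u = h v) (R : Finset ℝ) (𝓜 : Finset (Finset α))
    (h𝓜 : ∀ M ∈ 𝓜, ∃ a b c : ℝ, (∀ v ∈ V, a + b * g v + c * h v ≤ 0) ∧
      M = V.filter fun v => a + b * g v + c * h v = 0)
    (hR : ∀ M ∈ 𝓜, ∀ w ∈ M, (∀ v ∈ M, g v ≤ g w) → g w ∈ R) :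
    𝓜.card ≤ 3 * R.card + 2 := by
  -- The two sets left out account for the `+ 2`. Excluding `V` also excludes the degenerate line
  -- with all coefficients zero.
  set 𝓝 := 𝓜.filter fun M => M.Nonempty ∧ M ≠ V with h𝓝
  have hsub : 𝓜 ⊆ insert ∅ (insert V 𝓝) := by
    intro M hM
    simp only [Finset.mem_insert]
    by_cases h1 : M = ∅
    · exact Or.inl h1
    by_cases h2 : M = V
    · exact Or.inr (Or.inl h2)
    · exact Or.inr (Or.inr (Finset.mem_filter.2 ⟨hM, Finset.nonempty_iff_ne_empty.2 h1, h2⟩))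
  have hw : ∀ M : {M // M ∈ 𝓝}, ∃ w ∈ M.1, ∀ v ∈ M.1, g v ≤ g w := fun M =>
    Finset.exists_max_image _ _ (Finset.mem_filter.1 M.2).2.1
  choose w hwM hwmax using hw
  choose a b c hneg hM using fun M : {M // M ∈ 𝓝} => h𝓜 M.1 (Finset.mem_filter.1 M.2).1
  have hmem : ∀ (M : {M // M ∈ 𝓝}) v,
      v ∈ M.1 ↔ v ∈ V ∧ a M + b M * g v + c M * h v = 0 := by
    intro M v
    conv_lhs => rw [hM M]
    exact Finset.mem_filter
  -- A contact set is determined by its rightmost position and its kind: a single position, an upper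
  -- edge (`0 < c`) or a lower edge.
  let kind : {M // M ∈ 𝓝} → Fin 3 := fun M =>
    if ∀ v ∈ M.1, g v = g (w M) then 0 else if 0 < c M then 1 else 2
  have hinj : Function.Injective fun M => (g (w M), kind M) := by
    intro M M' heq
    obtain ⟨hg, hk⟩ := Prod.mk.inj heq
    have hwV := (hmem M _).1 (hwM M)
    have hwV' := (hmem M' _).1 (hwM M')
    have hh := hgh _ hwV.1 _ hwV'.1 hg
    have hz' : a M' + b M' * g (w M) + c M' * h (w M) = 0 := by rw [hg, hh]; exact hwV'.2
    -- Both lines pass through the rightmost point `w M`. If one also touches `u` to its left, the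
    -- other, being supporting, has its slope bounded on one side. Used in both directions, this
    -- forces equal slopes.
    have slope : ∀ N N' : {M // M ∈ 𝓝}, ∀ u, a N + b N * g u + c N * h u ≤ 0 →
        a N' + b N' * g u + c N' * h u = 0 → g u < g (w M) →
        a N + b N * g (w M) + c N * h (w M) = 0 → a N' + b N' * g (w M) + c N' * h (w M) = 0 →
        (0 < c N' → b N' * c N ≤ b N * c N') ∧ (c N' < 0 → b N * c N' ≤ b N' * c N) := by
      intro N N' u h1 h2 h3 h4 h5
      have e : c N' * (a N + b N * g u + c N * h u) =
          (b N * c N' - b N' * c N) * (g u - g (w M)) := by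
        linear_combination c N * h2 - c N * h5 + c N' * h4
      constructor
      · intro hc
        by_contra! hcon
        nlinarith [mul_pos (sub_pos.2 hcon) (sub_pos.2 h3), mul_nonneg hc.le (neg_nonneg.2 h1)]
      · intro hc
        by_contra! hcon
        nlinarith [mul_pos (sub_pos.2 hcon) (sub_pos.2 h3),
          mul_nonneg (neg_nonneg.2 hc.le) (neg_nonneg.2 h1)]
    have single : ∀ N : {M // M ∈ 𝓝}, ∀ u ∈ N.1, g u ≠ g (w N) → c N ≠ 0 := by
      intro N u hu hne hc
      have h1 := ((hmem N u).1 hu).2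
      have h2 := ((hmem N _).1 (hwM N)).2
      rw [hc] at h1 h2
      have hb : b N = 0 := by
        have : b N * (g u - g (w N)) = 0 := by linarith
        exact (mul_eq_zero.1 this).resolve_right (sub_ne_zero.2 hne)
      have ha : a N = 0 := by rw [hb] at h1; linarith
      refine (Finset.mem_filter.1 N.2).2.2 ?_
      ext v
      rw [hmem N v, ha, hb, hc]
      simp
    have final : c M ≠ 0 → c M' ≠ 0 → b M' * c M = b M * c M' → M = M' := by
      intro hc hc' hb
      refine Subtype.ext (Finset.ext fun v => ?_)
      rw [hmem M v, hmem M' v]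
      refine and_congr_right fun _ => ?_
      have e : c M' * (a M + b M * g v + c M * h v) = c M * (a M' + b M' * g v + c M' * h v) := by
        linear_combination c M' * hwV.2 - c M * hz' - (g v - g (w M)) * hb
      constructor
      · intro h0
        rw [h0, mul_zero] at e
        exact (mul_eq_zero.1 e.symm).resolve_left hc
      · intro h0
        rw [h0, mul_zero] at e
        exact (mul_eq_zero.1 e).resolve_left hc'
    by_cases hs : ∀ v ∈ M.1, g v = g (w M)
    · have hs' : ∀ v ∈ M'.1, g v = g (w M') := by
        by_contra hs'
        simp only [kind, if_pos hs, if_neg hs'] at hk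
        split_ifs at hk <;> simp at hk
      refine Subtype.ext (Finset.ext fun v => ⟨fun hv => ?_, fun hv => ?_⟩)
      · have hvV := ((hmem M v).1 hv).1
        have hgv : g v = g (w M') := (hs v hv).trans hg
        rw [hmem M' v, hgv, hgh v hvV _ hwV'.1 hgv]
        exact ⟨hvV, hwV'.2⟩
      · have hvV := ((hmem M' v).1 hv).1
        have hgv : g v = g (w M) := (hs' v hv).trans hg.symm
        rw [hmem M v, hgv, hgh v hvV _ hwV.1 hgv]
        exact ⟨hvV, hwV.2⟩
    · have hs' : ¬ ∀ v ∈ M'.1, g v = g (w M') := by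
        intro hs'
        simp only [kind, if_neg hs, if_pos hs'] at hk
        split_ifs at hk <;> simp at hk
      have hk' : (0 < c M ↔ 0 < c M') := by
        simp only [kind, if_neg hs, if_neg hs'] at hk
        split_ifs at hk with h1 h2 h2
        · exact ⟨fun _ => h2, fun _ => h1⟩
        · simp at hk
        · simp at hk
        · exact ⟨fun h => absurd h h1, fun h => absurd h h2⟩
      push Not at hs hs'
      obtain ⟨u, hu, hne⟩ := hs
      obtain ⟨u', hu', hne'⟩ := hs'
      have hc := single M u hu hne
      have hc' := single M' u' hu' hne'
      have hlt : g u < g (w M) := lt_of_le_of_ne (hwmax M u hu) hne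
      have hlt' : g u' < g (w M) := by
        rw [hg]
        exact lt_of_le_of_ne (hwmax M' u' hu') hne'
      have huV := (hmem M u).1 hu
      have huV' := (hmem M' u').1 hu'
      have s1 := slope M M' u' (hneg M u' huV'.1) huV'.2 hlt' hwV.2 hz'
      have s2 := slope M' M u (hneg M' u huV.1) huV.2 hlt hz' hwV.2
      refine final hc hc' ?_
      rcases lt_or_gt_of_ne hc with h1 | h1
      · have h2 : c M' < 0 := lt_of_le_of_ne (not_lt.1 fun h => absurd (hk'.2 h) (not_lt.2 h1.le)) hc'
        exact le_antisymm (s2.2 h1) (s1.2 h2)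
      · exact le_antisymm (s1.1 (hk'.1 h1)) (s2.1 h1)
  have hcard : 𝓝.card ≤ R.card * 3 := by
    have h1 : 𝓝.attach.card ≤ (R ×ˢ (Finset.univ : Finset (Fin 3))).card := by
      refine Finset.card_le_card_of_injOn (fun M => (g (w M), kind M)) ?_ hinj.injOn
      intro M _
      exact Finset.mem_product.2 ⟨hR M.1 (Finset.mem_filter.1 M.2).1 _ (hwM M) (hwmax M),
        Finset.mem_univ _⟩
    simpa using h1
  have h1 := Finset.card_le_card hsub
  have h2 := Finset.card_insert_le ∅ (insert V 𝓝)
  have h3 := Finset.card_insert_le V 𝓝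
  omega

/-- The number of edges at `p`. -/
def edgeDegree (V : Finset E3) (p : E3) : ℕ := (V.filter fun q => IsEdge V p q).card

theorem exists_generic_combination {ι : Type*} (s : Finset ι) (f g : ι → ℝ) :
    ∃ t : ℝ, ∀ i ∈ s, f i + t * g i = 0 → f i = 0 ∧ g i = 0 := by
  obtain ⟨t, ht⟩ := Infinite.exists_notMem_finset (s.image fun i => - f i / g i)
  refine ⟨t, fun i hi h => ?_⟩
  by_cases hg : g i = 0
  · exact ⟨by simpa [hg] using h, hg⟩
  · refine absurd (Finset.mem_image.2 ⟨i, hi, ?_⟩) ht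
    rw [div_eq_iff hg]
    linarith

/-- At a vertex `p` of the hull, the number of contact sets through `p` is bounded by the number
of edges at `p`. -/
theorem card_contactSets_at_vertex_le {V : Finset E3} {p : E3} (hp : p ∈ V) {m : E3 →ₗ[ℝ] ℝ}
    (hm0 : m ≠ 0) (hm : ∀ v ∈ V, v ≠ p → m v < m p) (𝓜 : Finset (Finset E3))
    (h𝓜 : ∀ M ∈ 𝓜, ∃ l : E3 →ₗ[ℝ] ℝ, (∀ v ∈ V, l v ≤ l p) ∧ M = V.filter fun v => l v = l p) :
    𝓜.card ≤ 3 * edgeDegree V p + 2 := by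
  obtain ⟨f, h, hspan⟩ := exists_spanning_functionals hm0
  set U := V.erase p with hU
  have hUV : ∀ v, v ∈ U ↔ v ≠ p ∧ v ∈ V := fun v => Finset.mem_erase
  set τ : E3 → ℝ := fun v => m p - m v with hτ
  have hτpos : ∀ v ∈ U, 0 < τ v := fun v hv => sub_pos.2 (hm v ((hUV v).1 hv).2 ((hUV v).1 hv).1)
  -- The vertex figure: directions from `p`, scaled to the plane `m = -1`. Points on one ray from
  -- `p` have the same image.
  set w : E3 → E3 := fun v => (τ v)⁻¹ • (v - p) with hw
  have hτw : ∀ v ∈ U, τ v • w v = v - p := fun v hv => smul_inv_smul₀ (hτpos v hv).ne' _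
  have hmw : ∀ v ∈ U, m (w v) = -1 := by
    intro v hv
    have h1 := (hτpos v hv).ne'
    simp only [hw, map_smul, map_sub, smul_eq_mul]
    rw [inv_mul_eq_iff_eq_mul₀ h1]
    simp only [hτ]
    ring
  -- Generic `t` makes the first coordinate `G` separate distinct points of the vertex figure.
  obtain ⟨t, ht⟩ := exists_generic_combination (U ×ˢ U) (fun e => f (w e.1 - w e.2))
    (fun e => h (w e.1 - w e.2))
  set G : E3 →ₗ[ℝ] ℝ := f + t • h with hG
  have hGv : ∀ v, G v = f v + t * h v := fun v => rfl
  have hwinj : ∀ u ∈ U, ∀ v ∈ U, G (w u) = G (w v) → w u = w v := by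
    intro u hu v hv huv
    have h1 := ht (u, v) (Finset.mk_mem_product hu hv) (by
      simp only [hGv, map_sub] at huv ⊢
      linarith)
    rw [← sub_eq_zero]
    refine (Module.forall_dual_apply_eq_zero_iff ℝ _).1 fun l => ?_
    obtain ⟨a, b, c, hl⟩ := hspan l
    rw [hl, h1.1, h1.2, map_sub, hmw u hu, hmw v hv]
    simp
  have hsplit : ∀ (l : E3 →ₗ[ℝ] ℝ), ∀ v ∈ U, l v = l p + τ v * l (w v) := by
    intro l v hv
    rw [← smul_eq_mul, ← map_smul, hτw v hv, map_sub]
    ring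
  set 𝓝 := 𝓜.image fun M => M.erase p with h𝓝
  have hpM : ∀ M ∈ 𝓜, p ∈ M := by
    intro M hM
    obtain ⟨l, -, rfl⟩ := h𝓜 M hM
    exact Finset.mem_filter.2 ⟨hp, rfl⟩
  have hcard : 𝓝.card = 𝓜.card := by
    refine Finset.card_image_of_injOn fun M hM M' hM' heq => ?_
    rw [← Finset.insert_erase (hpM M hM), ← Finset.insert_erase (hpM M' hM')]
    exact congrArg (insert p) heq
  have h𝓝mem : ∀ N ∈ 𝓝, ∃ l : E3 →ₗ[ℝ] ℝ, (∀ v ∈ U, l (w v) ≤ 0) ∧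
      ∀ v, v ∈ N ↔ v ∈ U ∧ l (w v) = 0 := by
    intro N hN
    obtain ⟨M, hM, rfl⟩ := Finset.mem_image.1 hN
    obtain ⟨l, hl, rfl⟩ := h𝓜 M hM
    refine ⟨l, fun v hv => ?_, fun v => ?_⟩
    · have h1 := hl v ((hUV v).1 hv).2
      rw [hsplit l v hv] at h1
      by_contra! hcon
      have := mul_pos (hτpos v hv) hcon
      linarith
    · rw [Finset.mem_erase, Finset.mem_filter, ← and_assoc, ← hUV]
      refine and_congr_right fun hv => ?_
      rw [hsplit l v hv, add_eq_left, mul_eq_zero]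
      simp [(hτpos v hv).ne']
  rw [← hcard]
  set R := (V.filter fun q => IsEdge V p q).image fun v => G (w v) with hR
  have hRcard : R.card ≤ edgeDegree V p := Finset.card_image_le
  refine (card_contactSets_le U (fun v => G (w v)) (fun v => h (w v)) ?_ R 𝓝 ?_ ?_).trans
    (by omega)
  · intro u hu v hv huv
    exact congrArg h (hwinj u hu v hv huv)
  · intro N hN
    obtain ⟨l, hl, hlN⟩ := h𝓝mem N hN
    obtain ⟨a, b, c, habc⟩ := hspan l
    have e : ∀ v ∈ U, -a + b * G (w v) + (c - b * t) * h (w v) = l (w v) := by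
      intro v hv
      rw [habc, hmw v hv, hGv]
      ring
    refine ⟨-a, b, c - b * t, fun v hv => (e v hv).trans_le (hl v hv), Finset.ext fun v => ?_⟩
    rw [hlN, Finset.mem_filter]
    exact and_congr_right fun hv => by rw [e v hv]
  · intro N hN u huN hmax
    obtain ⟨l, hl, hlN⟩ := h𝓝mem N hN
    have huU := ((hlN u).1 huN).1
    have hlu := ((hlN u).1 huN).2
    -- The edge ends at the farthest point of `V` on the ray through `u`.
    obtain ⟨q, hq, hqmax⟩ := Finset.exists_max_image (U.filter fun v => G (w v) = G (w u)) τ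
      ⟨u, Finset.mem_filter.2 ⟨huU, rfl⟩⟩
    obtain ⟨hqU, hqu⟩ := Finset.mem_filter.1 hq
    have hwq : w q = w u := hwinj q hqU u huU hqu
    refine Finset.mem_image.2 ⟨q, Finset.mem_filter.2 ⟨((hUV q).1 hqU).2, ?_⟩, hqu⟩
    obtain ⟨ε, hε, hεneg⟩ := exists_pos_forall_add_mul_neg (U.filter fun v => l (w v) < 0)
      (fun v => l (w v)) (fun v => G (w v) - G (w u)) (fun v hv => (Finset.mem_filter.1 hv).2)
    -- Since `m = -1` on the vertex figure, the tilt adds `ε * (G (w v) - G (w u))`. This is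
    -- negative on the other contact directions because `u` is rightmost; elsewhere `l` stays
    -- negative for small `ε`.
    set l' : E3 →ₗ[ℝ] ℝ := l + ε • (G + G (w u) • m) with hl'
    have hl'w : ∀ v ∈ U, l' (w v) = l (w v) + ε * (G (w v) - G (w u)) := by
      intro v hv
      simp only [hl', LinearMap.add_apply, LinearMap.smul_apply, smul_eq_mul, hmw v hv]
      ring
    have hl'q : l' p = l' q := by
      rw [hsplit l' q hqU, hl'w q hqU, hwq, hlu]
      simp
    refine ⟨hp, ((hUV q).1 hqU).2, ((hUV q).1 hqU).1.symm, l', hl'q, fun v hv => ?_⟩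
    by_cases hvp : v = p
    · subst hvp
      exact ⟨le_rfl, fun _ => left_mem_segment ℝ _ _⟩
    have hvU : v ∈ U := (hUV v).2 ⟨hvp, hv⟩
    have hτv := hτpos v hvU
    by_cases hgv : G (w v) = G (w u)
    · have hwv : w v = w u := hwinj v hvU u huU hgv
      refine ⟨?_, fun _ => ?_⟩
      · rw [hsplit l' v hvU, hl'w v hvU, hwv, hlu]
        simp
      · have hle : τ v ≤ τ q := hqmax v (Finset.mem_filter.2 ⟨hvU, hgv⟩)
        have hτq := hτpos q hqU
        rw [segment_eq_image']
        refine ⟨τ v / τ q, ⟨by positivity, (div_le_one hτq).2 hle⟩, ?_⟩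
        have h1 : q - p = τ q • w v := by rw [hwv, ← hwq, hτw q hqU]
        simp only
        rw [h1, smul_smul, div_mul_cancel₀ _ hτq.ne', hτw v hvU]
        abel
    · have hneg : l' (w v) < 0 := by
        by_cases hlv : l (w v) < 0
        · rw [hl'w v hvU]
          exact hεneg v (Finset.mem_filter.2 ⟨hvU, hlv⟩)
        · have h0 : l (w v) = 0 := le_antisymm (hl v hvU) (not_lt.1 hlv)
          have hlt : G (w v) < G (w u) :=
            lt_of_le_of_ne (hmax v ((hlN v).2 ⟨hvU, h0⟩)) hgv
          rw [hl'w v hvU, h0, zero_add]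
          exact mul_neg_of_pos_of_neg hε (sub_neg.2 hlt)
      have hlt : l' v < l' p := by
        rw [hsplit l' v hvU]
        have := mul_neg_of_pos_of_neg hτv hneg
        linarith
      exact ⟨hlt.le, fun h => absurd h hlt.ne⟩

/-! ### Faces created by one insertion. -/

/-- A face is the hull of the points on it. -/
theorem closure_convexHull_inter_eq {V : Set E3} (hV : V.Finite) {F : Set E3}
    (hF : IsExposed ℝ (convexHull ℝ V) F) : closure (convexHull ℝ (F ∩ V)) = F := by
  have hc : IsCompact (convexHull ℝ V) := hV.isCompact_convexHull (𝕜 := ℝ)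
  have hFc := hF.isCompact hc
  have hFconv := hF.convex (convex_convexHull ℝ V)
  have hext : F.extremePoints ℝ ⊆ F ∩ V := fun x hx =>
    ⟨hx.1, extremePoints_convexHull_subset
      (hF.isExtreme.extremePoints_subset_extremePoints hx)⟩
  apply Set.Subset.antisymm
  · exact closure_minimal (convexHull_min Set.inter_subset_left hFconv) hFc.isClosed
  · conv_lhs => rw [← closure_convexHull_extremePoints hFc hFconv]
    exact closure_mono (convexHull_mono hext)

/-- A face is recovered from the points of `V` on it, so it suffices to count contact sets. -/
theorem ncard_hullFaces_at_vertex_le {V : Finset E3} {p : E3} (hp : p ∈ V) {m : E3 →ₗ[ℝ] ℝ}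
    (hm : ∀ v ∈ V, v ≠ p → m v < m p) :
    {F ∈ hullFaces (V : Set E3) | p ∈ F}.ncard ≤ 3 * edgeDegree V p + 2 := by
  have hfin : {F ∈ hullFaces (V : Set E3) | p ∈ F}.Finite :=
    (hullFaces_finite V.finite_toSet).subset (Set.sep_subset _ _)
  -- The functional `m` can vanish only if `p` is the sole point; then any nonzero functional
  -- serves.
  obtain ⟨m', hm0, hm'⟩ : ∃ m' : E3 →ₗ[ℝ] ℝ, m' ≠ 0 ∧ ∀ v ∈ V, v ≠ p → m' v < m' p := by
    by_cases hm0 : m = 0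
    · obtain ⟨m', hm'⟩ := exists_ne (0 : E3 →ₗ[ℝ] ℝ)
      refine ⟨m', hm', fun v hv hvp => ?_⟩
      have := hm v hv hvp
      simp [hm0] at this
    · exact ⟨m, hm0, hm⟩
  set φ : Set E3 → Finset E3 := fun F => V.filter fun v => v ∈ F with hφ
  have hφ' : ∀ F, ((φ F : Finset E3) : Set E3) = F ∩ V := by
    intro F
    ext v
    simp [hφ, and_comm]
  have hinj : Set.InjOn φ {F ∈ hullFaces (V : Set E3) | p ∈ F} := by
    intro F hF F' hF' heq
    rw [← closure_convexHull_inter_eq V.finite_toSet hF.1.2.1,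
      ← closure_convexHull_inter_eq V.finite_toSet hF'.1.2.1, ← hφ', ← hφ', heq]
  rw [Set.ncard_eq_toFinset_card _ hfin, ← Finset.card_image_of_injOn (f := φ)
    (by rwa [Set.Finite.coe_toFinset])]
  refine card_contactSets_at_vertex_le hp hm0 hm' _ fun M hM => ?_
  obtain ⟨F, hF, rfl⟩ := Finset.mem_image.1 hM
  obtain ⟨hF, hpF⟩ := (Set.Finite.mem_toFinset hfin).1 hF
  obtain ⟨l, hl⟩ := hF.2.1 hF.1
  rw [hl] at hpF
  refine ⟨l.toLinearMap, fun v hv => hpF.2 v (subset_convexHull ℝ _ hv), ?_⟩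
  simp only [hφ]
  refine Finset.filter_congr fun v hv => ?_
  rw [hl]
  constructor
  · intro h
    exact le_antisymm (hpF.2 v h.1) (h.2 p hpF.1)
  · intro h
    refine ⟨subset_convexHull ℝ _ hv, fun y hy => ?_⟩
    have h' : l v = l p := h
    rw [h']
    exact hpF.2 y hy

/-- The number of faces created by the insertion of a point. -/
def createdFaces (V W : Set E3) : ℕ := (hullFaces W \ hullFaces V).ncard

/-- A point of the old hull changes nothing. Otherwise Hahn–Banach separation makes `p` a vertex,
and a new face avoiding `p` would be spanned by old points, hence be an old face. -/
theorem createdFaces_insert_le (V : Finset E3) (p : E3) :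
    createdFaces (V : Set E3) (insert p V : Finset E3) ≤ 3 * edgeDegree (insert p V) p + 2 := by
  have hVW : (V : Set E3) ⊆ (insert p V : Finset E3) := by simp
  by_cases hpV : p ∈ convexHull ℝ (V : Set E3)
  · have he : convexHull ℝ ((insert p V : Finset E3) : Set E3) = convexHull ℝ (V : Set E3) := by
      apply Set.Subset.antisymm
      · refine convexHull_min ?_ (convex_convexHull ℝ _)
        rw [Finset.coe_insert]
        exact Set.insert_subset hpV (subset_convexHull ℝ _)
      · exact convexHull_mono hVW
    have h0 : createdFaces (V : Set E3) (insert p V : Finset E3) = 0 := by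
      unfold createdFaces hullFaces
      rw [he, Set.sdiff_self, Set.ncard_empty]
    omega
  have hcomp : IsCompact (convexHull ℝ (V : Set E3)) :=
    V.finite_toSet.isCompact_convexHull (𝕜 := ℝ)
  obtain ⟨m, s, hms, hsm⟩ := geometric_hahn_banach_closed_point (convex_convexHull ℝ (V : Set E3))
    hcomp.isClosed hpV
  have hm : ∀ v ∈ insert p V, v ≠ p → m.toLinearMap v < m.toLinearMap p := by
    intro v hv hvp
    have hv' := (Finset.mem_insert.1 hv).resolve_left hvp
    exact (hms v (subset_convexHull ℝ _ hv')).trans hsm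
  refine le_trans (Set.ncard_le_ncard ?_ ?_)
    (ncard_hullFaces_at_vertex_le (Finset.mem_insert_self p V) hm)
  · rintro F ⟨hF, hFV⟩
    refine ⟨hF, ?_⟩
    by_contra hpF
    refine hFV ⟨hF.1, fun _ => ?_, hF.2.2⟩
    have hsub : F ⊆ convexHull ℝ (V : Set E3) := by
      rw [← closure_convexHull_inter_eq (Finset.finite_toSet _) hF.2.1]
      refine closure_minimal (convexHull_mono ?_) hcomp.isClosed
      rintro x ⟨hxF, hx⟩
      refine (Finset.mem_insert.1 hx).resolve_left ?_
      rintro rfl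
      exact hpF hxF
    obtain ⟨l, hl⟩ := hF.2.1 hF.1
    refine ⟨l, Set.Subset.antisymm (fun x hx => ⟨hsub hx, fun y hy => ?_⟩) fun x hx => ?_⟩
    · rw [hl] at hx
      exact hx.2 y (convexHull_mono hVW hy)
    · obtain ⟨x₀, hx₀⟩ := hF.1
      have h0 := hx.2 x₀ (hsub hx₀)
      rw [hl] at hx₀ ⊢
      exact ⟨convexHull_mono hVW hx.1, fun y hy => (hx₀.2 y hy).trans h0⟩
  · exact (hullFaces_finite (Finset.finite_toSet _)).subset (Set.sep_subset _ _)

/-! ### Sums along an insertion order. -/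

/-- The sum of `f` over the steps of inserting the points of `L`, one by one, into `V`. -/
def runSum (f : Set E3 → Set E3 → ℕ) (V : Set E3) (L : List E3) : ℕ :=
  ∑ t ∈ Finset.range L.length, f (V ∪ {p | p ∈ L.take t}) (V ∪ {p | p ∈ L.take (t + 1)})

theorem runSum_append (f : Set E3 → Set E3 → ℕ) (V : Set E3) (L L' : List E3) :
    runSum f V (L ++ L') = runSum f V L + runSum f (V ∪ {p | p ∈ L}) L' := by
  unfold runSum
  rw [List.length_append, Finset.sum_range_add]
  congr 1
  · refine Finset.sum_congr rfl fun t ht => ?_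
    have ht := Finset.mem_range.1 ht
    rw [List.take_append_of_le_length (by omega), List.take_append_of_le_length (by omega)]
  · refine Finset.sum_congr rfl fun t _ => ?_
    have e : ∀ k, V ∪ {p | p ∈ (L ++ L').take (L.length + k)} =
        V ∪ {p | p ∈ L} ∪ {p | p ∈ L'.take k} := by
      intro k
      rw [List.take_length_add_append, Set.union_assoc]
      congr 1
      ext p
      simp
    rw [add_assoc, e, e]

theorem runSum_flatMap_ofFn {A : Type*} (f : Set E3 → Set E3 → ℕ) (g : A → List E3) :
    ∀ (m : ℕ) (e : Fin m → A) (V : Set E3), runSum f V ((List.ofFn e).flatMap g) =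
      ∑ i, runSum f (V ∪ {x | ∃ i' < i, x ∈ g (e i')}) (g (e i)) := by
  intro m
  induction m with
  | zero => intro e V; simp [runSum]
  | succ m ih =>
    intro e V
    rw [List.ofFn_succ, List.flatMap_cons, runSum_append, ih, Fin.sum_univ_succ]
    congr 1
    · congr 1
      ext x
      simp
    · refine Finset.sum_congr rfl fun i _ => ?_
      congr 1
      rw [Set.union_assoc]
      congr 1
      ext x
      simp [Fin.exists_fin_succ]

theorem runSum_ofFn (f : Set E3 → Set E3 → ℕ) (m : ℕ) (φ : Fin m → E3) (V : Set E3) :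
    runSum f V (List.ofFn φ) = ∑ j, f (V ∪ {x | ∃ j' < j, x = φ j'})
      (insert (φ j) (V ∪ {x | ∃ j' < j, x = φ j'})) := by
  have h := runSum_flatMap_ofFn f (fun x => [x]) m φ V
  have e : (List.ofFn φ).flatMap (fun x => [x]) = List.ofFn φ := by simp
  rw [e] at h
  rw [h]
  refine Finset.sum_congr rfl fun j _ => ?_
  have hs : {p : E3 | p = φ j} = {φ j} := rfl
  simp [runSum, hs, Set.union_comm]

/-- In this form the face counts telescope: all changes together are twice the creations minus the
final number of faces. -/
theorem structuralChanges_add (V W : Finset E3) :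
    structuralChanges (V : Set E3) W + (hullFaces (W : Set E3)).ncard =
      2 * createdFaces (V : Set E3) W + (hullFaces (V : Set E3)).ncard := by
  have hV := hullFaces_finite V.finite_toSet
  have hW := hullFaces_finite W.finite_toSet
  have h1 := Set.ncard_sdiff_add_ncard (hullFaces (W : Set E3)) (hullFaces (V : Set E3)) hW hV
  have h2 := Set.ncard_sdiff_add_ncard (hullFaces (V : Set E3)) (hullFaces (W : Set E3)) hV hW
  rw [Set.union_comm] at h2
  unfold structuralChanges createdFaces
  omega

theorem totalChanges_le (L : List E3) : totalChanges L ≤ 2 * runSum createdFaces ∅ L := by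
  have e : ∀ t, {p | p ∈ L.take t} = ((L.take t).toFinset : Set E3) := fun t => by ext; simp
  have key : ∀ k, ∑ t ∈ Finset.range k,
      structuralChanges {p | p ∈ L.take t} {p | p ∈ L.take (t + 1)} +
        (hullFaces {p | p ∈ L.take k}).ncard =
      2 * ∑ t ∈ Finset.range k, createdFaces {p | p ∈ L.take t} {p | p ∈ L.take (t + 1)} := by
    intro k
    induction k with
    | zero =>
      have h0 : hullFaces {p | p ∈ L.take 0} = ∅ := by
        refine Set.eq_empty_of_forall_notMem fun F hF => ?_
        obtain ⟨x, hx⟩ := hF.1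
        have := hF.2.1.subset hx
        simp at this
      rw [h0]
      simp
    | succ k ih =>
      have h := structuralChanges_add (L.take k).toFinset (L.take (k + 1)).toFinset
      rw [← e, ← e] at h
      rw [Finset.sum_range_succ, Finset.sum_range_succ]
      omega
  have h := key L.length
  unfold totalChanges runSum
  simp only [Set.empty_union]
  omega

theorem runSum_createdFaces_le_totalChanges (L : List E3) :
    runSum createdFaces ∅ L ≤ totalChanges L := by
  unfold totalChanges runSum
  simp only [Set.empty_union]
  exact Finset.sum_le_sum fun t _ => Nat.le_add_right _ _

section Classes

variable {A : Type*} [Fintype A]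

/-- The points of the classes before the class `a`. -/
def classesBefore (C : A → Finset E3) {m : ℕ} (e : Fin m ≃ A) (a : A) : Finset E3 :=
  (Finset.univ.filter fun a' => e.symm a' < e.symm a).biUnion C

/-- The first `k` points of a sequence. -/
def firstPoints {c : ℕ} {D : Finset E3} (φ : Fin c ≃ {p // p ∈ D}) (k : ℕ) : Finset E3 :=
  (Finset.univ.filter fun j : Fin c => (j : ℕ) < k).image fun j => (φ j : E3)

theorem firstPoints_succ {c : ℕ} {D : Finset E3} (φ : Fin c ≃ {p // p ∈ D}) (j : Fin c) :
    firstPoints φ ((j : ℕ) + 1) = insert (φ j : E3) (firstPoints φ j) := by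
  have h : (Finset.univ.filter fun i : Fin c => (i : ℕ) < (j : ℕ) + 1) =
      insert j (Finset.univ.filter fun i : Fin c => (i : ℕ) < (j : ℕ)) := by
    ext i
    simp only [Finset.mem_filter, Finset.mem_univ, true_and, Finset.mem_insert, Fin.ext_iff]
    omega
  unfold firstPoints
  rw [h, Finset.image_insert]

theorem firstPoints_subset {c : ℕ} {D : Finset E3} (φ : Fin c ≃ {p // p ∈ D}) (k : ℕ) :
    firstPoints φ k ⊆ D := by
  intro x hx
  obtain ⟨j, -, rfl⟩ := Finset.mem_image.1 hx
  exact (φ j).2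

theorem runSum_insertionOrder {κ : Type*} (f : Set E3 → Set E3 → ℕ) (S : Finset E3)
    (color : E3 → κ) (ω : Orders S color) :
    runSum f ∅ (insertionOrder S color ω) = ∑ a, ∑ j : Fin _,
      f (classesBefore (fun a : {a // a ∈ colors S color} => colorClass S color a) ω.1 a ∪
          firstPoints (ω.2 a) j : Finset E3)
        (insert (ω.2 a j : E3)
          (classesBefore (fun a : {a // a ∈ colors S color} => colorClass S color a) ω.1 a ∪
          firstPoints (ω.2 a) j) : Finset E3) := by
  unfold insertionOrder
  rw [runSum_flatMap_ofFn, ← Equiv.sum_comp ω.1]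
  refine Finset.sum_congr rfl fun i _ => ?_
  rw [runSum_ofFn]
  refine Finset.sum_congr rfl fun j _ => ?_
  have hset : (∅ ∪ {x | ∃ i' < i, x ∈ List.ofFn fun j => (ω.2 (ω.1 i') j : E3)}) ∪
      {x | ∃ j' < j, x = (ω.2 (ω.1 i) j' : E3)} =
      ((classesBefore (fun a : {a // a ∈ colors S color} => colorClass S color a) ω.1 (ω.1 i) ∪
          firstPoints (ω.2 (ω.1 i)) j : Finset E3) : Set E3) := by
    rw [Finset.coe_union, Set.empty_union]
    congr 1
    · ext x
      simp only [classesBefore, Set.mem_ofPred_eq, Finset.mem_coe, Finset.mem_biUnion,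
        Finset.mem_filter, Finset.mem_univ, true_and, Equiv.symm_apply_apply, List.mem_ofFn]
      constructor
      · rintro ⟨i', hi', j', rfl⟩
        exact ⟨ω.1 i', by simpa using hi', (ω.2 (ω.1 i') j').2⟩
      · rintro ⟨a', ha', hx⟩
        refine ⟨ω.1.symm a', ha', ?_⟩
        rw [Equiv.apply_symm_apply]
        exact ⟨(ω.2 a').symm ⟨x, hx⟩, by simp⟩
    · ext x
      simp [firstPoints, eq_comm]
  rw [hset, Finset.coe_insert]

end Classes

/-! ### Backward analysis by transpositions. -/

section Swap

variable {Ω X : Type*} {c : ℕ}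

/-- The first elements of an ordering, up to position `j`. -/
def prefixSet (e : Fin c ≃ X) (j : Fin c) : Finset X := (Finset.Iic j).image e

theorem prefixSet_swap (e : Fin c ≃ X) {i j : Fin c} (hij : i ≤ j) :
    prefixSet ((Equiv.swap i j).trans e) j = prefixSet e j := by
  have hle : ∀ k ≤ j, Equiv.swap i j k ≤ j := by
    intro k hk
    rw [Equiv.swap_apply_def]
    split_ifs <;> first | assumption | exact le_rfl
  ext x
  simp only [prefixSet, Finset.mem_image, Finset.mem_Iic, Equiv.trans_apply]
  constructor
  · rintro ⟨k, hk, rfl⟩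
    exact ⟨_, hle k hk, rfl⟩
  · rintro ⟨k, hk, rfl⟩
    exact ⟨Equiv.swap i j k, hle k hk, by rw [Equiv.swap_apply_self]⟩

/-- In a random ordering, the last element of a prefix is a uniform element of the prefix. -/
theorem sum_prefixSet_swap [Fintype Ω] (e : Ω → (Fin c ≃ X)) (j : Fin c)
    (G : Ω → Finset X → X → ℝ) (ψ : Fin c → Ω → Ω) (hψ : ∀ i, Function.Involutive (ψ i))
    (he : ∀ i ω, e (ψ i ω) = (Equiv.swap i j).trans (e ω)) (hG : ∀ i ω, G (ψ i ω) = G ω) :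
    ∑ ω, ((j : ℝ) + 1) * G ω (prefixSet (e ω) j) (e ω j) =
      ∑ ω, ∑ x ∈ prefixSet (e ω) j, G ω (prefixSet (e ω) j) x := by
  have h1 : ∀ ω, ∑ x ∈ prefixSet (e ω) j, G ω (prefixSet (e ω) j) x =
      ∑ i ∈ Finset.Iic j, G ω (prefixSet (e ω) j) (e ω i) := fun ω =>
    Finset.sum_image fun i _ i' _ h => (e ω).injective h
  rw [Finset.sum_congr rfl fun ω _ => h1 ω, Finset.sum_comm]
  -- The involution `ψ i` keeps the prefix and brings its `i`-th element to the last place, so all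
  -- `i ≤ j` contribute equally.
  have h2 : ∀ i ∈ Finset.Iic j, ∑ ω, G ω (prefixSet (e ω) j) (e ω i) =
      ∑ ω, G ω (prefixSet (e ω) j) (e ω j) := by
    intro i hi
    rw [← Equiv.sum_comp (Function.Involutive.toPerm (ψ i) (hψ i))]
    refine Finset.sum_congr rfl fun ω _ => ?_
    have e1 : Function.Involutive.toPerm (ψ i) (hψ i) ω = ψ i ω := rfl
    rw [e1, he, hG, prefixSet_swap _ (Finset.mem_Iic.1 hi), Equiv.trans_apply,
      Equiv.swap_apply_left]
  rw [Finset.sum_congr rfl h2, Finset.sum_const, Fin.card_Iic, ← Finset.mul_sum, nsmul_eq_mul]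
  push_cast
  rfl

end Swap

theorem firstPoints_eq_image {c : ℕ} {D : Finset E3} (φ : Fin c ≃ {p // p ∈ D}) (j : Fin c) :
    firstPoints φ ((j : ℕ) + 1) = (prefixSet φ j).image Subtype.val := by
  have h : (Finset.univ.filter fun i : Fin c => (i : ℕ) < (j : ℕ) + 1) = Finset.Iic j := by
    ext i
    simp only [Finset.mem_filter, Finset.mem_univ, true_and, Finset.mem_Iic, Fin.le_def]
    omega
  ext x
  simp only [firstPoints, prefixSet, h, Finset.mem_image, exists_exists_and_eq_and]

section Classes

variable {A : Type*} [Fintype A] [DecidableEq A] {C : A → Finset E3} {m : ℕ}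

/-- The orderings of the classes together with orderings of the points of each class. -/
abbrev ClassOrders (C : A → Finset E3) (m : ℕ) : Type _ :=
  (Fin m ≃ A) × ((a : A) → (Fin (C a).card ≃ {p // p ∈ C a}))

/-- The transposition touches only the order inside class `a`, so `G` may depend on the order of the
classes. -/
theorem sum_firstPoints_swap (G : (Fin m ≃ A) → Finset E3 → E3 → ℝ) (a : A)
    (j : Fin (C a).card) :
    ∑ ω : ClassOrders C m,
        ((j : ℝ) + 1) * G ω.1 (firstPoints (ω.2 a) ((j : ℕ) + 1)) (ω.2 a j) =
      ∑ ω : ClassOrders C m, ∑ p ∈ firstPoints (ω.2 a) ((j : ℕ) + 1),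
        G ω.1 (firstPoints (ω.2 a) ((j : ℕ) + 1)) p := by
  have h := sum_prefixSet_swap (Ω := ClassOrders C m) (fun ω => ω.2 a) j
    (fun ω P x => G ω.1 (P.image Subtype.val) x)
    (fun i ω => (ω.1, Function.update ω.2 a ((Equiv.swap i j).trans (ω.2 a)))) ?_ ?_ ?_
  · simp only [firstPoints_eq_image]
    rw [h]
    refine Finset.sum_congr rfl fun ω _ => ?_
    rw [Finset.sum_image fun x _ y _ hxy => Subtype.ext hxy]
  · intro i ω
    refine Prod.ext rfl ?_
    simp only [Function.update_self, Function.update_idem]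
    rw [← Equiv.trans_assoc]
    have : (Equiv.swap i j).trans (Equiv.swap i j) = Equiv.refl _ := by
      ext k
      simp
    rw [this, Equiv.refl_trans, Function.update_eq_self]
  · intro i ω
    simp
  · intro i ω
    rfl

theorem sum_prefixClasses_swap (F : Finset A → A → ℝ) (i : Fin m) :
    ∑ e : Fin m ≃ A, ((i : ℝ) + 1) * F (prefixSet e i) (e i) =
      ∑ e : Fin m ≃ A, ∑ a ∈ prefixSet e i, F (prefixSet e i) a := by
  refine sum_prefixSet_swap (Ω := Fin m ≃ A) id i (fun _ => F)
    (fun k e => (Equiv.swap k i).trans e) (fun k e => ?_) (fun k e => rfl) fun _ _ => rfl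
  ext x
  simp

end Classes

/-! ### Random sampling of classes. -/

theorem two_pow_card_le {A : Type*} {R Y : Finset A} {a : A} (ha : a ∈ R) (haY : a ∉ Y)
    (hY : Y.card ≤ 1) :
    2 ^ R.card ≤ 4 * (R.powerset.filter fun T => a ∈ T ∧ Disjoint T Y).card := by
  rw [← Finset.card_powerset]
  set 𝓣 := R.powerset.filter fun T => a ∈ T ∧ Disjoint T Y
  -- A subset is recovered from its image: at `a` by the Boolean, on `Y` by the last component,
  -- elsewhere by the first. So each good subset has at most `2 * 2 ^ Y.card ≤ 4` preimages.
  have h : R.powerset.card ≤ (𝓣 ×ˢ ((Finset.univ : Finset Bool) ×ˢ Y.powerset)).card := by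
    refine Finset.card_le_card_of_injOn
      (fun T => (insert a (T \ Y), (decide (a ∈ T), T ∩ Y))) (fun T hT => ?_) ?_
    · have hT : T ⊆ R := Finset.mem_powerset.1 hT
      simp only [Finset.coe_product, Set.mem_prod, Finset.mem_coe, Finset.mem_univ, true_and,
        Finset.mem_powerset, Finset.inter_subset_right, and_true, 𝓣, Finset.mem_filter,
        Finset.mem_insert_self, Finset.disjoint_insert_left]
      exact ⟨Finset.insert_subset ha (Finset.sdiff_subset.trans hT), haY,
        Finset.sdiff_disjoint⟩
    · intro T _ T' _ heq
      simp only [Prod.mk.injEq, decide_eq_decide] at heq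
      obtain ⟨h1, h2, h3⟩ := heq
      ext x
      have e1 := Finset.ext_iff.1 h1 x
      have e3 := Finset.ext_iff.1 h3 x
      simp only [Finset.mem_insert, Finset.mem_sdiff, Finset.mem_inter] at e1 e3
      by_cases hx : x = a
      · rw [hx]; exact h2
      · tauto
  rw [Finset.card_product, Finset.card_product, Finset.card_univ, Fintype.card_bool,
    Finset.card_powerset Y] at h
  have h2 : 2 ^ Y.card ≤ 2 ^ 1 := Nat.pow_le_pow_right (by norm_num) hY
  have h3 := Nat.mul_le_mul_left 𝓣.card (Nat.mul_le_mul_left 2 h2)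
  omega

/-- The total number of edges at the points of a partial class, each inserted last, is linear. -/
theorem sum_edgeDegree_lastClass_le {A : Type*} {C J : A → Finset E3} (R : Finset A)
    (hJ : ∀ a, J a ⊆ C a) (hC : ∀ a b p, p ∈ C a → p ∈ C b → a = b) :
    ∑ a ∈ R, ∑ p ∈ J a, edgeDegree ((R.erase a).biUnion C ∪ J a) p ≤
      64 * ∑ a ∈ R, (C a).card := by
  set W : A → Finset E3 := fun a => (R.erase a).biUnion C ∪ J a with hW
  -- The sample: classes in `T` are cut down to `J`, the others stay whole. For `a ∈ T` it is
  -- contained in `W a`, so edges of `W a` with both endpoints in the sample remain edges.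
  set V : Finset A → Finset E3 := fun T => (R \ T).biUnion C ∪ T.biUnion J with hV
  set X : Finset (Σ _ : A, E3 × E3) := R.sigma fun a =>
    (J a ×ˢ W a).filter fun e => IsEdge (W a) e.1 e.2 with hX
  have hXcard : X.card = ∑ a ∈ R, ∑ p ∈ J a, edgeDegree (W a) p := by
    rw [hX, Finset.card_sigma]
    refine Finset.sum_congr rfl fun a _ => ?_
    rw [Finset.card_filter, Finset.sum_product]
    refine Finset.sum_congr rfl fun p _ => ?_
    rw [edgeDegree, Finset.card_filter]
  rw [← hXcard]
  have hXmem : ∀ x ∈ X, x.1 ∈ R ∧ x.2.1 ∈ J x.1 ∧ x.2.2 ∈ W x.1 ∧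
      IsEdge (W x.1) x.2.1 x.2.2 := by
    intro x hx
    obtain ⟨h1, h2⟩ := Finset.mem_sigma.1 hx
    obtain ⟨h2, h3⟩ := Finset.mem_filter.1 h2
    obtain ⟨h4, h5⟩ := Finset.mem_product.1 h2
    exact ⟨h1, h4, h5, h3⟩
  let good : (Σ _ : A, E3 × E3) → Finset A → Prop := fun x T => x.1 ∈ T ∧ x.2.2 ∈ V T
  have hdouble : ∑ x ∈ X, (R.powerset.filter fun T => good x T).card =
      ∑ T ∈ R.powerset, (X.filter fun x => good x T).card :=
    Finset.sum_card_bipartiteAbove_eq_sum_card_bipartiteBelow good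
  have hlow : ∀ x ∈ X, 2 ^ R.card ≤ 4 * (R.powerset.filter fun T => good x T).card := by
    intro x hx
    obtain ⟨h1, -, h3, -⟩ := hXmem x hx
    -- An edge survives once its class is in `T` and the class of its other endpoint, if different,
    -- is not: at least a quarter of all `T`.
    have main : ∀ Y : Finset A, x.1 ∉ Y → Y.card ≤ 1 →
        (∀ T, T ⊆ R → x.1 ∈ T → Disjoint T Y → x.2.2 ∈ V T) →
        2 ^ R.card ≤ 4 * (R.powerset.filter fun T => good x T).card := by
      intro Y ha hY h
      refine (two_pow_card_le h1 ha hY).trans (Nat.mul_le_mul_left _ (Finset.card_le_card ?_))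
      intro T hT
      obtain ⟨hT, haT, hTY⟩ := Finset.mem_filter.1 hT
      exact Finset.mem_filter.2 ⟨hT, haT, h T (Finset.mem_powerset.1 hT) haT hTY⟩
    rcases Finset.mem_union.1 h3 with h | h
    · obtain ⟨b, hb, hq⟩ := Finset.mem_biUnion.1 h
      obtain ⟨hba, hbR⟩ := Finset.mem_erase.1 hb
      refine main {b} (by simpa using hba.symm) (by simp) fun T _ _ hTb => ?_
      refine Finset.mem_union_left _ (Finset.mem_biUnion.2 ⟨b, Finset.mem_sdiff.2 ⟨hbR, ?_⟩, hq⟩)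
      simpa using hTb
    · exact main ∅ (by simp) (by simp) fun T _ haT _ =>
        Finset.mem_union_right _ (Finset.mem_biUnion.2 ⟨_, haT, h⟩)
  have hup : ∀ T ∈ R.powerset, (X.filter fun x => good x T).card ≤
      16 * ∑ a ∈ R, (C a).card := by
    intro T hT
    have hT : T ⊆ R := Finset.mem_powerset.1 hT
    have hVW : ∀ a ∈ T, V T ⊆ W a := by
      intro a ha p hp
      rcases Finset.mem_union.1 hp with h | h
      · obtain ⟨b, hb, hpb⟩ := Finset.mem_biUnion.1 h
        obtain ⟨hbR, hbT⟩ := Finset.mem_sdiff.1 hb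
        refine Finset.mem_union_left _ (Finset.mem_biUnion.2 ⟨b, Finset.mem_erase.2 ⟨?_, hbR⟩, hpb⟩)
        rintro rfl
        exact hbT ha
      · obtain ⟨b, hbT, hpb⟩ := Finset.mem_biUnion.1 h
        by_cases hba : b = a
        · subst hba
          exact Finset.mem_union_right _ hpb
        · exact Finset.mem_union_left _ (Finset.mem_biUnion.2
            ⟨b, Finset.mem_erase.2 ⟨hba, hT hbT⟩, hJ b hpb⟩)
    have h1 : (X.filter fun x => good x T).card ≤
        ((V T ×ˢ V T).filter fun e => IsEdge (V T) e.1 e.2).card := by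
      refine Finset.card_le_card_of_injOn (fun x => x.2) (fun x hx => ?_) ?_
      · obtain ⟨hx, hxT, hq⟩ := Finset.mem_filter.1 hx
        obtain ⟨-, hp, -, hE⟩ := hXmem x hx
        have hp' : x.2.1 ∈ V T := Finset.mem_union_right _ (Finset.mem_biUnion.2 ⟨_, hxT, hp⟩)
        exact Finset.mem_filter.2 ⟨Finset.mk_mem_product hp' hq, hE.mono (hVW _ hxT) hp' hq⟩
      -- Classes are disjoint, so the first endpoint determines the class and no edge is counted
      -- twice.
      · rintro ⟨a, e⟩ hx ⟨a', e'⟩ hx' heq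
        obtain ⟨-, hp, -⟩ := hXmem _ (Finset.mem_filter.1 hx).1
        obtain ⟨-, hp', -⟩ := hXmem _ (Finset.mem_filter.1 hx').1
        obtain rfl : e = e' := heq
        obtain rfl := hC a a' e.1 (hJ _ hp) (hJ _ hp')
        rfl
    have h2 : (V T).card ≤ ∑ a ∈ R, (C a).card := by
      refine (Finset.card_le_card ?_).trans Finset.card_biUnion_le
      refine Finset.union_subset (Finset.biUnion_subset_biUnion_of_subset_left _
        Finset.sdiff_subset) ?_
      refine Finset.biUnion_subset.2 fun a ha => (hJ a).trans ?_
      exact Finset.subset_biUnion_of_mem C (hT ha)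
    have h3 := card_edges_le (V T)
    omega
  have e1 : X.card * 2 ^ R.card ≤ ∑ x ∈ X, 4 * (R.powerset.filter fun T => good x T).card := by
    rw [← smul_eq_mul, ← Finset.sum_const]
    exact Finset.sum_le_sum hlow
  have e2 : ∑ T ∈ R.powerset, (X.filter fun x => good x T).card ≤
      2 ^ R.card * (16 * ∑ a ∈ R, (C a).card) := by
    rw [← Finset.card_powerset, ← smul_eq_mul, ← Finset.sum_const]
    exact Finset.sum_le_sum hup
  rw [← Finset.mul_sum, hdouble] at e1
  have hpos : 0 < 2 ^ R.card := by positivity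
  refine Nat.le_of_mul_le_mul_right ?_ hpos
  calc X.card * 2 ^ R.card ≤ 4 * (2 ^ R.card * (16 * ∑ a ∈ R, (C a).card)) :=
        e1.trans (Nat.mul_le_mul_left _ e2)
    _ = 64 * (∑ a ∈ R, (C a).card) * 2 ^ R.card := by ring

/-! ### Averaging over both orders. -/

section Classes

variable {A : Type*} [Fintype A] [DecidableEq A] {C : A → Finset E3} {m : ℕ}

theorem classesBefore_apply (e : Fin m ≃ A) (i : Fin m) :
    classesBefore C e (e i) = ((prefixSet e i).erase (e i)).biUnion C := by
  unfold classesBefore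
  congr 1
  ext a
  obtain ⟨k, rfl⟩ := e.surjective a
  simp only [Finset.mem_filter, Finset.mem_univ, true_and, Equiv.symm_apply_apply,
    Finset.mem_erase, prefixSet, Finset.mem_image, Finset.mem_Iic, EmbeddingLike.apply_eq_iff_eq,
    exists_eq_right, ne_eq]
  exact ⟨fun h => ⟨h.ne, h.le⟩, fun h => lt_of_le_of_ne h.2 h.1⟩

/-- The swap identity is applied at each position both to the degrees and to the class sizes. The
factor `i + 1` then cancels, and summing over positions counts each class once. -/
theorem sum_edgeDegree_classesBefore_le {J : A → Finset E3} (hJ : ∀ a, J a ⊆ C a)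
    (hC : ∀ a b p, p ∈ C a → p ∈ C b → a = b) :
    ∑ e : Fin m ≃ A, ∑ a, ∑ p ∈ J a, (edgeDegree (classesBefore C e a ∪ J a) p : ℝ) ≤
      (Fintype.card (Fin m ≃ A) : ℝ) * (64 * ∑ a, ((C a).card : ℝ)) := by
  have h1 : ∀ i : Fin m, ∑ e : Fin m ≃ A,
      ∑ p ∈ J (e i), (edgeDegree (classesBefore C e (e i) ∪ J (e i)) p : ℝ) ≤
      64 * ∑ e : Fin m ≃ A, ((C (e i)).card : ℝ) := by
    intro i
    simp only [classesBefore_apply]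
    have h2 := sum_prefixClasses_swap (A := A) (m := m)
      (fun P a => ∑ p ∈ J a, (edgeDegree ((P.erase a).biUnion C ∪ J a) p : ℝ)) i
    have h3 := sum_prefixClasses_swap (A := A) (m := m) (fun _ a => ((C a).card : ℝ)) i
    rw [← Finset.mul_sum] at h2 h3
    have h4 : ∑ e : Fin m ≃ A, ∑ a ∈ prefixSet e i,
        ∑ p ∈ J a, (edgeDegree (((prefixSet e i).erase a).biUnion C ∪ J a) p : ℝ) ≤
        64 * ∑ e : Fin m ≃ A, ∑ a ∈ prefixSet e i, ((C a).card : ℝ) := by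
      rw [Finset.mul_sum]
      refine Finset.sum_le_sum fun e _ => ?_
      have h5 := sum_edgeDegree_lastClass_le (prefixSet e i) hJ hC
      have h6 : ((∑ a ∈ prefixSet e i, ∑ p ∈ J a,
        edgeDegree (((prefixSet e i).erase a).biUnion C ∪ J a) p : ℕ) : ℝ) ≤
          ((64 * ∑ a ∈ prefixSet e i, (C a).card : ℕ) : ℝ) := by
        refine Nat.cast_le.2 (le_trans (le_of_eq ?_) h5)
        refine Finset.sum_congr rfl fun a _ => Finset.sum_congr rfl fun p _ => ?_
        congr!
      push_cast at h6
      exact h6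
    rw [← h2, ← h3] at h4
    have hpos : (0 : ℝ) < (i : ℝ) + 1 := by positivity
    refine le_of_mul_le_mul_left (h4.trans (le_of_eq ?_)) hpos
    ring
  have h2 : ∀ e : Fin m ≃ A,
      ∑ a, ∑ p ∈ J a, (edgeDegree (classesBefore C e a ∪ J a) p : ℝ) =
      ∑ i, ∑ p ∈ J (e i), (edgeDegree (classesBefore C e (e i) ∪ J (e i)) p : ℝ) := fun e =>
    (Equiv.sum_comp e fun a =>
      ∑ p ∈ J a, (edgeDegree (classesBefore C e a ∪ J a) p : ℝ)).symm
  rw [Finset.sum_congr rfl fun e _ => h2 e, Finset.sum_comm]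
  refine (Finset.sum_le_sum fun i _ => h1 i).trans (le_of_eq ?_)
  rw [← Finset.mul_sum, Finset.sum_comm]
  have h3 : ∀ e : Fin m ≃ A, ∑ i, ((C (e i)).card : ℝ) = ∑ a, ((C a).card : ℝ) := fun e =>
    Equiv.sum_comp e fun a => ((C a).card : ℝ)
  rw [Finset.sum_congr rfl fun e _ => h3 e, Finset.sum_const, Finset.card_univ, nsmul_eq_mul]
  ring

/-- The sum over all orders of the number of edges at the inserted points. -/
theorem sum_edgeDegree_insertion_le (hC : ∀ a b p, p ∈ C a → p ∈ C b → a = b) {n : ℕ}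
    (hn : ∑ a, (C a).card = n) :
    ∑ ω : ClassOrders C m, ∑ a, ∑ j : Fin (C a).card,
      (edgeDegree (classesBefore C ω.1 a ∪ firstPoints (ω.2 a) ((j : ℕ) + 1)) (ω.2 a j) : ℝ) ≤
      (Fintype.card (ClassOrders C m) : ℝ) * (64 * n * ∑ k ∈ Finset.range n, ((k : ℝ) + 1)⁻¹) := by
  set D : ClassOrders C m → A → ℕ → ℝ := fun ω a k =>
    ∑ p ∈ firstPoints (ω.2 a) (k + 1),
      (edgeDegree (classesBefore C ω.1 a ∪ firstPoints (ω.2 a) (k + 1)) p : ℝ) with hD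
  have hD0 : ∀ ω a k, 0 ≤ D ω a k := fun ω a k => Finset.sum_nonneg fun p _ => Nat.cast_nonneg _
  have h1 : ∀ a, ∀ j : Fin (C a).card, ∑ ω : ClassOrders C m,
      (edgeDegree (classesBefore C ω.1 a ∪ firstPoints (ω.2 a) ((j : ℕ) + 1)) (ω.2 a j) : ℝ) =
      ∑ ω, ((j : ℝ) + 1)⁻¹ * D ω a j := by
    intro a j
    have h := sum_firstPoints_swap (C := C) (m := m)
      (fun e J p => (edgeDegree (classesBefore C e a ∪ J) p : ℝ)) a j
    rw [← Finset.mul_sum] at h ⊢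
    have hpos : (j : ℝ) + 1 ≠ 0 := by positivity
    rw [eq_inv_mul_iff_mul_eq₀ hpos]
    exact h
  -- Extending the range to `n` by nonnegative terms makes it independent of `a`, so the sum over
  -- classes can be taken first, for fixed `k`.
  have h2 : ∀ a, ∀ ω, ∑ j : Fin (C a).card, ((j : ℝ) + 1)⁻¹ * D ω a j ≤
      ∑ k ∈ Finset.range n, ((k : ℝ) + 1)⁻¹ * D ω a k := by
    intro a ω
    rw [Fin.sum_univ_eq_sum_range (fun k => ((k : ℝ) + 1)⁻¹ * D ω a k)]
    refine Finset.sum_le_sum_of_subset_of_nonneg (Finset.range_subset_range.2 ?_) fun k _ _ => ?_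
    · rw [← hn]
      exact Finset.single_le_sum (f := fun a => (C a).card) (fun _ _ => Nat.zero_le _)
        (Finset.mem_univ a)
    · exact mul_nonneg (by positivity) (hD0 ω a k)
  -- With the inner orders fixed, the prefixes are fixed sets and only the class order is averaged.
  have h3 : ∀ k, ∑ ω, ∑ a, D ω a k ≤ (Fintype.card (ClassOrders C m) : ℝ) * (64 * n) := by
    intro k
    rw [Fintype.sum_prod_type_right, Fintype.card_prod]
    have h4 : ∀ ω₂ : ((a : A) → (Fin (C a).card ≃ {p // p ∈ C a})),
        ∑ e : Fin m ≃ A, ∑ a, D (e, ω₂) a k ≤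
          (Fintype.card (Fin m ≃ A) : ℝ) * (64 * n) := by
      intro ω₂
      have h := sum_edgeDegree_classesBefore_le (C := C) (m := m)
        (J := fun a => firstPoints (ω₂ a) (k + 1)) (fun a => firstPoints_subset _ _) hC
      rw [← Nat.cast_sum, hn] at h
      exact h
    refine (Finset.sum_le_sum fun ω₂ _ => h4 ω₂).trans (le_of_eq ?_)
    rw [Finset.sum_const, Finset.card_univ, nsmul_eq_mul]
    push_cast
    ring
  calc _ = ∑ a, ∑ ω : ClassOrders C m, ∑ j : Fin (C a).card, ((j : ℝ) + 1)⁻¹ * D ω a j := by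
        rw [Finset.sum_comm]
        refine Finset.sum_congr rfl fun a _ => ?_
        rw [Finset.sum_comm, Finset.sum_congr rfl fun j _ => h1 a j, Finset.sum_comm]
    _ ≤ ∑ a, ∑ ω : ClassOrders C m, ∑ k ∈ Finset.range n, ((k : ℝ) + 1)⁻¹ * D ω a k :=
        Finset.sum_le_sum fun a _ => Finset.sum_le_sum fun ω _ => h2 a ω
    _ = ∑ k ∈ Finset.range n, ((k : ℝ) + 1)⁻¹ * ∑ ω, ∑ a, D ω a k := by
        rw [Finset.sum_comm, Finset.sum_congr rfl fun ω _ => Finset.sum_comm, Finset.sum_comm]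
        simp only [Finset.mul_sum]
    _ ≤ ∑ k ∈ Finset.range n,
          ((k : ℝ) + 1)⁻¹ * ((Fintype.card (ClassOrders C m) : ℝ) * (64 * n)) :=
        Finset.sum_le_sum fun k _ => mul_le_mul_of_nonneg_left (h3 k) (by positivity)
    _ = _ := by
        rw [← Finset.sum_mul]
        ring

end Classes

/-! ### The upper bound. -/

section UpperBound

variable {κ : Type*} (S : Finset E3) (color : E3 → κ)

theorem sum_card_colorClass :
    ∑ a : {a // a ∈ colors S color}, (colorClass S color a).card = S.card := by
  rw [Finset.sum_coe_sort (colors S color) fun a => (colorClass S color a).card]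
  exact (Finset.card_eq_sum_card_image color S).symm

theorem colorClass_disjoint (a b : {a // a ∈ colors S color}) (p : E3)
    (ha : p ∈ colorClass S color a) (hb : p ∈ colorClass S color b) : a = b :=
  Subtype.ext ((Finset.mem_filter.1 ha).2.symm.trans (Finset.mem_filter.1 hb).2)

theorem expectedChanges_le :
    expectedChanges S color ≤
      2 * (3 * (64 * S.card * ∑ k ∈ Finset.range S.card, ((k : ℝ) + 1)⁻¹) + 2 * S.card) := by
  set C : {a // a ∈ colors S color} → Finset E3 := fun a => colorClass S color a with hC
  have hpos : (0 : ℝ) < Fintype.card (Orders S color) := Nat.cast_pos.2 Fintype.card_pos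
  unfold expectedChanges
  rw [div_le_iff₀ hpos]
  have h1 : ∀ ω : Orders S color, (totalChanges (insertionOrder S color ω) : ℝ) ≤
      2 * (3 * ∑ a, ∑ j : Fin (C a).card, (edgeDegree (classesBefore C ω.1 a ∪
        firstPoints (ω.2 a) ((j : ℕ) + 1)) (ω.2 a j) : ℝ) + 2 * S.card) := by
    intro ω
    have h2 := totalChanges_le (insertionOrder S color ω)
    rw [runSum_insertionOrder] at h2
    have h3 : ∑ a, ∑ j : Fin (C a).card,
        createdFaces (classesBefore C ω.1 a ∪ firstPoints (ω.2 a) j : Finset E3)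
          (insert (ω.2 a j : E3) (classesBefore C ω.1 a ∪ firstPoints (ω.2 a) j) : Finset E3) ≤
        ∑ a, ∑ j : Fin (C a).card, (3 * edgeDegree (classesBefore C ω.1 a ∪
          firstPoints (ω.2 a) ((j : ℕ) + 1)) (ω.2 a j) + 2) := by
      refine Finset.sum_le_sum fun a _ => Finset.sum_le_sum fun j _ => ?_
      rw [firstPoints_succ, Finset.union_insert]
      exact createdFaces_insert_le _ _
    have h4 : ∑ a, ∑ _j : Fin (C a).card, 2 = 2 * S.card := by
      simp only [Finset.sum_const, Finset.card_univ, Fintype.card_fin, smul_eq_mul]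
      rw [← Finset.sum_mul, sum_card_colorClass, mul_comm]
    simp only [Finset.sum_add_distrib, ← Finset.mul_sum] at h3
    have h5 := h2.trans (Nat.mul_le_mul_left 2 (h3.trans (Nat.add_le_add_left h4.le _)))
    exact_mod_cast h5
  have h2 := sum_edgeDegree_insertion_le (C := C) (m := (colors S color).card)
    (colorClass_disjoint S color) (sum_card_colorClass S color)
  refine (Finset.sum_le_sum fun ω _ => h1 ω).trans ?_
  rw [← Finset.mul_sum, Finset.sum_add_distrib, ← Finset.mul_sum, Finset.sum_const,
    Finset.card_univ, nsmul_eq_mul]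
  have h3 := mul_le_mul_of_nonneg_left h2 (by norm_num : (0 : ℝ) ≤ 3)
  linarith

theorem sum_inv_eq_harmonic (n : ℕ) :
    ∑ k ∈ Finset.range n, ((k : ℝ) + 1)⁻¹ = (harmonic n : ℝ) := by
  unfold harmonic
  push_cast
  rfl

/-- The bound `384 n H_n + 4 n` with `H_n ≤ 1 + log n` leaves `388 n`, which is at most `776 n log
n` because `log n ≥ 1/2`; and `384 + 776 = 1160`. -/
theorem expectedChanges_le_log (hS : 2 ≤ S.card) :
    expectedChanges S color ≤ 1160 * (S.card * Real.log S.card) := by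
  have h := expectedChanges_le S color
  rw [sum_inv_eq_harmonic] at h
  have h1 := harmonic_le_one_add_log S.card
  have h2 : (1 / 2 : ℝ) ≤ Real.log S.card := by
    have h3 : Real.log 2 ≤ Real.log S.card :=
      Real.log_le_log (by norm_num) (by exact_mod_cast hS)
    have := Real.log_two_gt_d9
    linarith
  have h0 : (0 : ℝ) ≤ S.card := Nat.cast_nonneg _
  have h3 := mul_le_mul_of_nonneg_left h1 h0
  have h4 := mul_le_mul_of_nonneg_left h2 h0
  linarith

end UpperBound

/-! ### The lower bound: two parallel parabolas. -/

section LowerBound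

/-- The points of a second plane that see `p` as their nearest point among `J`. -/
def nearestTo (O J : Finset E3) (p : E3) : Finset E3 :=
  O.filter fun u => ∀ r ∈ J, (p 0 - u 0) ^ 2 ≤ (r 0 - u 0) ^ 2

theorem card_le_sum_nearestTo (O : Finset E3) {J : Finset E3} (hJ : J.Nonempty) :
    O.card ≤ ∑ p ∈ J, (nearestTo O J p).card := by
  refine (Finset.card_le_card fun u hu => ?_).trans Finset.card_biUnion_le
  obtain ⟨p, hp, hmin⟩ := Finset.exists_min_image J (fun r => (r 0 - u 0) ^ 2) hJ
  exact Finset.mem_biUnion.2 ⟨p, hp, Finset.mem_filter.2 ⟨hu, hmin⟩⟩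

/-- On two parallel parabolas, an inserted point creates a face for each point of the other
parabola to which it is nearest. -/
theorem card_nearestTo_le_createdFaces {O J : Finset E3} {p : E3} {τ : ℝ} (hpJ : p ∉ J)
    (hpar : ∀ s ∈ insert p (O ∪ J), s 1 = s 0 ^ 2)
    (hinj : Set.InjOn (fun s : E3 => s 0) (insert p (O ∪ J) : Finset E3))
    (hO : ∀ u ∈ O, u 2 = τ) (hJ : ∀ r ∈ J, r 2 = p 2) (hτ : p 2 ≠ τ) :
    (nearestTo O (insert p J) p).card ≤
      createdFaces (O ∪ J : Finset E3) (insert p (O ∪ J) : Finset E3) := by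
  set V := O ∪ J with hV
  set W := insert p V with hW
  have hpW : p ∈ W := Finset.mem_insert_self _ _
  have hpV : p ∉ V := by
    intro h
    rcases Finset.mem_union.1 h with h | h
    · exact hτ (hO p h)
    · exact hpJ h
  let x : E3 →L[ℝ] ℝ := EuclideanSpace.proj 0
  let y : E3 →L[ℝ] ℝ := EuclideanSpace.proj 1
  let z : E3 →L[ℝ] ℝ := EuclideanSpace.proj 2
  -- On the parabolas `2 * p 0 * x - y` equals `p 0 ^ 2 - (x - p 0) ^ 2`, which is largest at `p`
  -- alone.
  have hpconv : p ∉ convexHull ℝ (V : Set E3) := by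
    intro h
    have hm : convexHull ℝ (V : Set E3) ⊆
        {v | ((2 * p 0) • x - y) v < ((2 * p 0) • x - y) p} := by
      refine convexHull_min (fun v hv => ?_)
        (convex_halfSpace_lt ((2 * p 0) • x - y).toLinearMap.isLinear _)
      have hvW : v ∈ W := Finset.mem_insert_of_mem hv
      have hne : v 0 - p 0 ≠ 0 := by
        intro h0
        have := hinj hvW hpW (sub_eq_zero.1 h0)
        exact hpV (this ▸ hv)
      have e : ∀ w : E3, ((2 * p 0) • x - y) w = 2 * p 0 * w 0 - w 1 := fun w => rfl
      rw [Set.mem_ofPred_eq, e, e, hpar v hvW, hpar p hpW]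
      have := pow_pos (abs_pos.2 hne) 2
      rw [sq_abs] at this
      nlinarith
    have h' : ((2 * p 0) • x - y) p < ((2 * p 0) • x - y) p := hm h
    exact lt_irrefl _ h'
  -- Within either plane `l u` decreases with the distance of the first coordinate from `u 0`; the
  -- coefficient of `z` equalizes the values at `p` and `u`. So `l u` supports the hull at both, and
  -- as `u` is its only maximum in `O`, the face determines `u`.
  let l : E3 → E3 →L[ℝ] ℝ := fun u =>
    (2 * u 0) • x - y + ((p 0 - u 0) ^ 2 / (p 2 - τ)) • z
  have hl : ∀ u w : E3, l u w = 2 * u 0 * w 0 - w 1 + (p 0 - u 0) ^ 2 / (p 2 - τ) * w 2 :=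
    fun u w => rfl
  have hτ' : p 2 - τ ≠ 0 := sub_ne_zero.2 hτ
  let F : E3 → Set E3 := fun u =>
    {w ∈ convexHull ℝ (W : Set E3) | ∀ v ∈ convexHull ℝ (W : Set E3), l u v ≤ l u w}
  have hmem : ∀ u ∈ nearestTo O (insert p J) p, u ∈ O ∧ u ∈ W ∧ l u p = l u u ∧
      ∀ v ∈ W, l u v ≤ l u u ∧ (v ∈ O → l u v = l u u → v = u) := by
    intro u hu
    obtain ⟨huO, hnear⟩ := Finset.mem_filter.1 hu
    have huW : u ∈ W := Finset.mem_insert_of_mem (Finset.mem_union_left _ huO)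
    have hup : l u p = l u u := by
      rw [hl, hl, hpar p hpW, hpar u huW, hO u huO]
      field_simp
      ring
    refine ⟨huO, huW, hup, fun v hv => ⟨?_, fun hvO he => ?_⟩⟩
    · by_cases hvO : v ∈ O
      · rw [hl, hl, hpar v hv, hpar u huW, hO u huO, hO v hvO]
        nlinarith [sq_nonneg (v 0 - u 0)]
      · have hvJ : v ∈ insert p J := by
          rcases Finset.mem_insert.1 hv with h | h
          · exact Finset.mem_insert.2 (Or.inl h)
          · exact Finset.mem_insert_of_mem ((Finset.mem_union.1 h).resolve_left hvO)
        have hv2 : v 2 = p 2 := by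
          rcases Finset.mem_insert.1 hvJ with h | h
          · rw [h]
          · exact hJ v h
        rw [← hup, hl, hl, hpar v hv, hpar p hpW, hv2]
        have := hnear v hvJ
        nlinarith
    · rw [hl, hl, hpar v hv, hpar u huW, hO u huO, hO v hvO] at he
      have h0 : (v 0 - u 0) ^ 2 = 0 := by linarith
      exact hinj hv huW (sub_eq_zero.1 (pow_eq_zero_iff two_ne_zero |>.1 h0))
  have hmax : ∀ u ∈ nearestTo O (insert p J) p, ∀ v ∈ convexHull ℝ (W : Set E3),
      l u v ≤ l u u := by
    intro u hu v hv
    exact convexHull_min (fun w hw => ((hmem u hu).2.2.2 w hw).1)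
      (convex_halfSpace_le (l u).toLinearMap.isLinear _) hv
  rw [← Set.ncard_coe_finset]
  refine Set.ncard_le_ncard_of_injOn F (fun u hu => ?_) ?_
    ((hullFaces_finite (Finset.finite_toSet W)).subset Set.sdiff_subset)
  · have hu : u ∈ nearestTo O (insert p J) p := hu
    obtain ⟨huO, huW, hup, -⟩ := hmem u hu
    have hpF : p ∈ F u := ⟨subset_convexHull ℝ _ hpW, fun v hv => by
      rw [hup]
      exact hmax u hu v hv⟩
    refine ⟨⟨⟨p, hpF⟩, fun _ => ⟨l u, rfl⟩, ?_⟩, fun h => hpconv (h.2.1.subset hpF)⟩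
    have hlne : (l u).toLinearMap ≠ 0 := by
      intro h
      have h1 : l u (EuclideanSpace.single 1 1) = 0 := LinearMap.congr_fun h _
      rw [hl] at h1
      simp at h1
    have hker := Module.Dual.finrank_ker_add_one_of_ne_zero (K := ℝ) (f := (l u).toLinearMap) hlne
    rw [finrank_euclideanSpace_fin] at hker
    have hsub : vectorSpan ℝ (F u) ≤ LinearMap.ker (l u).toLinearMap := by
      refine Submodule.span_le.2 ?_
      rintro _ ⟨a, ha, b, hb, rfl⟩
      have h1 := le_antisymm (hb.2 a ha.1) (ha.2 b hb.1)
      simp [h1]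
    have := Submodule.finrank_mono hsub
    omega
  · intro u hu u' hu' heq
    have hu : u ∈ nearestTo O (insert p J) p := hu
    have hu' : u' ∈ nearestTo O (insert p J) p := hu'
    obtain ⟨huO, huW, -, huniq⟩ := hmem u hu
    have h1 : u' ∈ F u' := ⟨subset_convexHull ℝ _ (hmem u' hu').2.1, hmax u' hu'⟩
    rw [← heq] at h1
    exact ((huniq u' (hmem u' hu').2.1).2 (hmem u' hu').1
      (le_antisymm (hmax u hu u' h1.1) (h1.2 u (subset_convexHull ℝ _ huW)))).symm

section Classes

variable {A : Type*} [Fintype A] [DecidableEq A] {C : A → Finset E3} {m : ℕ}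

/-- The points of all classes other than `a`. -/
def otherClasses (C : A → Finset E3) (a : A) : Finset E3 := (Finset.univ.erase a).biUnion C

theorem classesBefore_of_last {e : Fin m ≃ A} {a : A} (h : ∀ a', e.symm a' ≤ e.symm a) :
    classesBefore C e a = otherClasses C a := by
  unfold classesBefore otherClasses
  congr 1
  ext b
  simp only [Finset.mem_filter, Finset.mem_univ, true_and, Finset.mem_erase, and_true]
  constructor
  · rintro hlt rfl
    exact lt_irrefl _ hlt
  · intro hne
    exact lt_of_le_of_ne (h b) fun he => hne (e.symm.injective he)

/-- If each class has `h` points outside it and `h` points in it, then, summed over all orders,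
the points of the last class are, when inserted, nearest to many points of the others. -/
theorem le_sum_nearestTo [Nonempty A] {h : ℕ} (hC : ∀ a, h ≤ (C a).card)
    (hO : ∀ a, h ≤ (otherClasses C a).card) :
    (Fintype.card (ClassOrders C m) : ℝ) * (h * ∑ k ∈ Finset.range h, ((k : ℝ) + 1)⁻¹) ≤
      ∑ ω : ClassOrders C m, ∑ a, ∑ j : Fin (C a).card,
        if ∀ a', ω.1.symm a' ≤ ω.1.symm a then
          ((nearestTo (otherClasses C a) (firstPoints (ω.2 a) ((j : ℕ) + 1))
            (ω.2 a j)).card : ℝ) else 0 := by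
  have h1 : ∀ a, ∀ j : Fin (C a).card,
      ∑ ω : ClassOrders C m, (if ∀ a', ω.1.symm a' ≤ ω.1.symm a then
        (h : ℝ) * ((j : ℝ) + 1)⁻¹ else 0) ≤
      ∑ ω : ClassOrders C m, if ∀ a', ω.1.symm a' ≤ ω.1.symm a then
          ((nearestTo (otherClasses C a) (firstPoints (ω.2 a) ((j : ℕ) + 1))
            (ω.2 a j)).card : ℝ) else 0 := by
    intro a j
    have hs := sum_firstPoints_swap (C := C) (m := m) (fun e J p =>
      if ∀ a', e.symm a' ≤ e.symm a then ((nearestTo (otherClasses C a) J p).card : ℝ) else 0) a j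
    rw [← Finset.mul_sum] at hs
    have hpos : (0 : ℝ) < (j : ℝ) + 1 := by positivity
    refine le_of_mul_le_mul_left ?_ hpos
    rw [hs, Finset.mul_sum]
    refine Finset.sum_le_sum fun ω _ => ?_
    split_ifs with hlast
    · rw [mul_left_comm, mul_inv_cancel₀ hpos.ne', mul_one]
      have hne : (firstPoints (ω.2 a) ((j : ℕ) + 1)).Nonempty := by
        rw [firstPoints_succ]
        exact Finset.insert_nonempty _ _
      exact_mod_cast (hO a).trans (card_le_sum_nearestTo (otherClasses C a) hne)
    · simp
  -- Every order has a last class, and this class alone provides the bound.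
  have h2 : ∀ ω : ClassOrders C m, (h : ℝ) * ∑ k ∈ Finset.range h, ((k : ℝ) + 1)⁻¹ ≤
      ∑ a, ∑ j : Fin (C a).card, if ∀ a', ω.1.symm a' ≤ ω.1.symm a then
        (h : ℝ) * ((j : ℝ) + 1)⁻¹ else 0 := by
    intro ω
    obtain ⟨a, -, ha⟩ := Finset.exists_max_image Finset.univ ω.1.symm Finset.univ_nonempty
    have ha' : ∀ a', ω.1.symm a' ≤ ω.1.symm a := fun a' => ha a' (Finset.mem_univ _)
    refine le_trans ?_ (Finset.single_le_sum (fun b _ => Finset.sum_nonneg fun j _ => ?_)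
      (Finset.mem_univ a))
    · simp only [if_pos ha']
      rw [← Finset.mul_sum, Fin.sum_univ_eq_sum_range (fun k => ((k : ℝ) + 1)⁻¹)]
      refine mul_le_mul_of_nonneg_left (Finset.sum_le_sum_of_subset_of_nonneg
        (Finset.range_subset_range.2 (hC a)) fun k _ _ => by positivity) (Nat.cast_nonneg _)
    · split_ifs
      · positivity
      · exact le_rfl
  calc _ = ∑ _ω : ClassOrders C m, (h : ℝ) * ∑ k ∈ Finset.range h, ((k : ℝ) + 1)⁻¹ := by
        rw [Finset.sum_const, Finset.card_univ, nsmul_eq_mul]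
    _ ≤ _ := Finset.sum_le_sum fun ω _ => h2 ω
    _ = ∑ a, ∑ j : Fin (C a).card, ∑ ω : ClassOrders C m,
        (if ∀ a', ω.1.symm a' ≤ ω.1.symm a then (h : ℝ) * ((j : ℝ) + 1)⁻¹ else 0) := by
        rw [Finset.sum_comm]
        exact Finset.sum_congr rfl fun a _ => Finset.sum_comm
    _ ≤ _ := Finset.sum_le_sum fun a _ => Finset.sum_le_sum fun j _ => h1 a j
    _ = _ := by
        rw [Finset.sum_comm]
        refine Finset.sum_congr rfl fun a _ => Finset.sum_comm

end Classes

/-- The points of two parallel parabolas, numbered by the first coordinate. -/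
def parabolaPoint (i : ℕ) : E3 := !₂[(i : ℝ), (i : ℝ) ^ 2, ((i % 2 : ℕ) : ℝ)]

def parabolaPoints (n : ℕ) : Finset E3 := (Finset.range n).image parabolaPoint

def parabolaColor (s : E3) : ℕ := if s 2 = 0 then 0 else 1

theorem parabolaPoint_injective : Function.Injective parabolaPoint := by
  intro i j h
  have h0 : parabolaPoint i 0 = parabolaPoint j 0 := by rw [h]
  simpa [parabolaPoint] using h0

theorem card_parabolaPoints (n : ℕ) : (parabolaPoints n).card = n := by
  rw [parabolaPoints, Finset.card_image_of_injective _ parabolaPoint_injective, Finset.card_range]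

theorem parabolaColor_parabolaPoint (i : ℕ) : parabolaColor (parabolaPoint i) = i % 2 := by
  rcases Nat.mod_two_eq_zero_or_one i with h | h <;> simp [parabolaColor, parabolaPoint, h]

theorem parabolaPoint_height (i : ℕ) :
    parabolaPoint i 2 = (parabolaColor (parabolaPoint i) : ℝ) := by
  rw [parabolaColor_parabolaPoint]
  simp [parabolaPoint]

theorem half_le_card_of_parity {n t : ℕ} (ht : t < 2) {D : Finset E3}
    (hD : ∀ i < n, i % 2 = t → parabolaPoint i ∈ D) : n / 2 ≤ D.card := by
  have h : (Finset.range (n / 2)).card ≤ D.card := by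
    refine Finset.card_le_card_of_injOn (fun i => parabolaPoint (2 * i + t)) (fun i hi => ?_) ?_
    · have hi := Finset.mem_range.1 hi
      exact hD _ (by omega) (by omega)
    · intro i _ j _ hij
      have := parabolaPoint_injective hij
      omega
  rwa [Finset.card_range] at h

theorem mem_colorClass {κ : Type*} {S : Finset E3} {color : E3 → κ} {a : κ} {s : E3} :
    s ∈ colorClass S color a ↔ s ∈ S ∧ color s = a := Finset.mem_filter

theorem mem_colors {κ : Type*} {S : Finset E3} {color : E3 → κ} {a : κ} :
    a ∈ colors S color ↔ ∃ s ∈ S, color s = a := Finset.mem_image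

/-- A lower bound for two classes on parallel parabolas. -/
theorem le_expectedChanges_of_parallel {κ : Type*} {S : Finset E3} {color : E3 → κ} {h : ℕ}
    (hne : S.Nonempty) (hpar : ∀ s ∈ S, s 1 = s 0 ^ 2)
    (hinj : Set.InjOn (fun s : E3 => s 0) S)
    (hheight : ∀ a ∈ colors S color, ∃ τ τ' : ℝ, τ ≠ τ' ∧
      ∀ s ∈ S, (color s = a → s 2 = τ) ∧ (color s ≠ a → s 2 = τ'))
    (hcard : ∀ a ∈ colors S color, h ≤ (colorClass S color a).card)
    (hcard' : ∀ a ∈ colors S color, h ≤ (S \ colorClass S color a).card) :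
    (h : ℝ) * ∑ k ∈ Finset.range h, ((k : ℝ) + 1)⁻¹ ≤ expectedChanges S color := by
  set C : {a // a ∈ colors S color} → Finset E3 := fun a => colorClass S color a with hC
  have hCS : ∀ a, ∀ s ∈ C a, s ∈ S := fun a s hs => (mem_colorClass.1 hs).1
  have hOmem : ∀ a s, s ∈ otherClasses C a ↔ s ∈ S ∧ color s ≠ a := by
    intro a s
    simp only [otherClasses, Finset.mem_biUnion, Finset.mem_erase, Finset.mem_univ, and_true]
    constructor
    · rintro ⟨b, hb, hs⟩
      obtain ⟨hs, he⟩ := mem_colorClass.1 hs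
      exact ⟨hs, fun h => hb (Subtype.ext (he.symm.trans h))⟩
    · rintro ⟨hs, hne⟩
      exact ⟨⟨color s, mem_colors.2 ⟨s, hs, rfl⟩⟩, fun h => hne (congrArg Subtype.val h),
        mem_colorClass.2 ⟨hs, rfl⟩⟩
  have hO : ∀ a, otherClasses C a = S \ C a := by
    intro a
    ext s
    rw [hOmem, Finset.mem_sdiff, hC, mem_colorClass]
    tauto
  have hne : Nonempty {a // a ∈ colors S color} := by
    obtain ⟨s, hs⟩ := hne
    exact ⟨⟨color s, mem_colors.2 ⟨s, hs, rfl⟩⟩⟩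
  have hmain := le_sum_nearestTo (C := C) (m := (colors S color).card) (h := h)
    (fun a => hcard a a.2) (fun a => by rw [hO]; exact hcard' a a.2)
  have hpos : (0 : ℝ) < Fintype.card (Orders S color) := Nat.cast_pos.2 Fintype.card_pos
  unfold expectedChanges
  rw [le_div_iff₀ hpos, mul_comm]
  refine hmain.trans (Finset.sum_le_sum fun ω _ => ?_)
  have h1 := runSum_createdFaces_le_totalChanges (insertionOrder S color ω)
  rw [runSum_insertionOrder] at h1
  refine le_trans ?_ (Nat.cast_le.2 h1)
  rw [Nat.cast_sum]
  refine Finset.sum_le_sum fun a _ => ?_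
  rw [Nat.cast_sum]
  refine Finset.sum_le_sum fun j _ => ?_
  split_ifs with hlast
  · have hp : (ω.2 a j : E3) ∈ C a := (ω.2 a j).2
    have hJ : firstPoints (ω.2 a) j ⊆ C a := firstPoints_subset _ _
    have hsub : insert (ω.2 a j : E3) (otherClasses C a ∪ firstPoints (ω.2 a) j) ⊆ S := by
      refine Finset.insert_subset (hCS a _ hp) (Finset.union_subset (fun s hs => ?_) fun s hs => ?_)
      · exact ((hOmem a s).1 hs).1
      · exact hCS a s (hJ hs)
    obtain ⟨τ, τ', hττ', hh⟩ := hheight a a.2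
    have hcolor : ∀ s ∈ C a, s 2 = τ := fun s hs =>
      (hh s (hCS a s hs)).1 (mem_colorClass.1 hs).2
    rw [Nat.cast_le, firstPoints_succ, classesBefore_of_last hlast]
    refine card_nearestTo_le_createdFaces (τ := τ') ?_
      (fun s hs => hpar s (hsub hs)) (hinj.mono (by exact_mod_cast hsub)) ?_ ?_ ?_
    · intro h
      obtain ⟨i, hi, he⟩ := Finset.mem_image.1 h
      have hij := (ω.2 a).injective (Subtype.ext he)
      rw [hij] at hi
      exact lt_irrefl _ (Finset.mem_filter.1 hi).2
    · intro u hu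
      obtain ⟨huS, hua⟩ := (hOmem a u).1 hu
      exact (hh u huS).2 hua
    · intro r hr
      rw [hcolor _ hp, hcolor r (hJ hr)]
    · rwa [hcolor _ hp]
  · exact Nat.cast_nonneg _

theorem le_expectedChanges_parabola {n : ℕ} (hn : 2 ≤ n) :
    ((n / 2 : ℕ) : ℝ) * ∑ k ∈ Finset.range (n / 2), ((k : ℝ) + 1)⁻¹ ≤
      expectedChanges (parabolaPoints n) parabolaColor := by
  have hmemS : ∀ s, s ∈ parabolaPoints n ↔ ∃ i < n, parabolaPoint i = s := fun s => by
    simp [parabolaPoints]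
  have hcol : ∀ a ∈ colors (parabolaPoints n) parabolaColor, a < 2 := by
    intro a ha
    obtain ⟨s, -, rfl⟩ := mem_colors.1 ha
    simp only [parabolaColor]
    split_ifs <;> norm_num
  refine le_expectedChanges_of_parallel ⟨_, (hmemS _).2 ⟨0, by omega, rfl⟩⟩ ?_ ?_ ?_ ?_ ?_
  · intro s hs
    obtain ⟨i, -, rfl⟩ := (hmemS s).1 hs
    simp [parabolaPoint]
  · intro s hs s' hs' h
    obtain ⟨i, -, rfl⟩ := (hmemS s).1 hs
    obtain ⟨j, -, rfl⟩ := (hmemS s').1 hs'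
    have : i = j := by simpa [parabolaPoint] using h
    rw [this]
  · intro a ha
    have ha2 := hcol a ha
    -- As `a < 2`, the truncated difference `1 - a` is the other parity.
    refine ⟨(a : ℝ), ((1 - a : ℕ) : ℝ), fun h => ?_, fun s hs => ?_⟩
    · have := Nat.cast_injective h
      omega
    · obtain ⟨i, -, rfl⟩ := (hmemS s).1 hs
      rw [parabolaPoint_height, parabolaColor_parabolaPoint]
      refine ⟨fun h => by rw [h], fun h => ?_⟩
      have : i % 2 = 1 - a := by omega
      rw [this]
  · intro a ha
    refine half_le_card_of_parity (hcol a ha) fun i hi hia => ?_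
    exact mem_colorClass.2 ⟨(hmemS _).2 ⟨i, hi, rfl⟩, by rw [parabolaColor_parabolaPoint, hia]⟩
  · intro a ha
    have ha2 := hcol a ha
    refine half_le_card_of_parity (t := 1 - a) (by omega) fun i hi hia => ?_
    refine Finset.mem_sdiff.2 ⟨(hmemS _).2 ⟨i, hi, rfl⟩, fun h => ?_⟩
    have := (mem_colorClass.1 h).2
    rw [parabolaColor_parabolaPoint] at this
    omega

/-- The constant is `1 / (3 * 2)`: `n ≤ 3 * (n / 2)` in integer division, and `n ≤ (n / 2 + 1) ^ 2`
gives `log n ≤ 2 * harmonic (n / 2)`. -/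
theorem le_expectedChanges_parabola_log {n : ℕ} (hn : 2 ≤ n) :
    1 / 6 * (n * Real.log n) ≤ expectedChanges (parabolaPoints n) parabolaColor := by
  refine le_trans ?_ (le_expectedChanges_parabola hn)
  rw [sum_inv_eq_harmonic]
  have h1 := log_add_one_le_harmonic (n / 2)
  have hn' : (n : ℝ) ≤ 3 * ((n / 2 : ℕ) : ℝ) := by
    have : n ≤ 3 * (n / 2) := by omega
    exact_mod_cast this
  have h2 : Real.log n ≤ 2 * Real.log ((n / 2 + 1 : ℕ) : ℝ) := by
    rw [← Nat.cast_ofNat, ← Real.log_pow]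
    refine Real.log_le_log (by exact_mod_cast (by omega : 0 < n)) ?_
    have : n ≤ (n / 2 + 1) ^ 2 := by nlinarith [Nat.div_add_mod n 2, Nat.mod_lt n two_pos]
    exact_mod_cast this
  have h3 : 0 ≤ Real.log n := Real.log_natCast_nonneg n
  have h4 : Real.log n ≤ 2 * (harmonic (n / 2) : ℝ) := by linarith
  have h5 := mul_le_mul hn' h4 h3 (by positivity)
  linarith

end LowerBound

end ColoredHull

end

theorem mainTheorem6 :
    (∃ C : ℝ, 0 < C ∧ ∀ (κ : Type*) (n : ℕ) (S : Finset E3) (color : E3 → κ),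
      2 ≤ n → S.card = n →
        ColoredHull.expectedChanges S color ≤ C * (n * Real.log n)) ∧
    (∃ c : ℝ, 0 < c ∧ ∀ n : ℕ, 2 ≤ n → ∃ (S : Finset E3) (color : E3 → ℕ),
      S.card = n ∧ c * (n * Real.log n) ≤ ColoredHull.expectedChanges S color) := by
  refine ⟨⟨1160, by norm_num, ?_⟩, 1 / 6, by norm_num, fun n hn => ?_⟩
  · rintro κ n S color hn rfl
    exact ColoredHull.expectedChanges_le_log S color hn
  · exact ⟨ColoredHull.parabolaPoints n, ColoredHull.parabolaColor,
      ColoredHull.card_parabolaPoints n, ColoredHull.le_expectedChanges_parabola_log hn⟩
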